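/- All operators act on a finite-dimensional complex Hilbert space, and $\log$ is the natural logarithm. For Hermitian $A,B$, let $\{A>B\}$ denote the orthogonal projection onto the span of the eigenvectors of $A-B$ with positive eigenvalues, and $\{A\le B\}$ the orthogonal projection onto the span of the eigenvectors of $A-B$ with nonpositive eigenvalues. Integrals $\int_0^\infty g(\gamma)\,\mathrm{d}F(\gamma)$ are Riemann--Stieltjes integrals (possibly with matrix-valued integrator $F$), with $\int_0^\infty=\lim_{b\to\infty}\int_0^b$ for $g(\gamma)=\gamma\log\gamma$ (where $0\log 0=0$) and $\int_0^\infty=\lim_{a\downarrow 0,\,b\to\infty}\int_a^b$ for $g(\gamma)=\log\gamma$. All the integrals below exist. (1) For all positive definite $A,B$, $$\log A-\log B=-\int_0^\infty \log\gamma\,\mathrm{d}\{A>\gamma B\}.$$ (2) Let $\rho,\sigma$ be quantum states (positive semidefinite with trace one) with $D_{\max}(\rho\Vert\sigma):=\inf\{\lambda\in\mathbb{R}:\rho\le e^{\lambda}\sigma\}<\infty$. Let $D(\rho\Vert\sigma)=\operatorname{Tr}[\rho(\log\rho-\log\sigma)]$ if $\operatorname{supp}\rho\subseteq\operatorname{supp}\sigma$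 (logarithms taken on the supports, extended by $0$), and $D(\rho\Vert\sigma)=\infty$ otherwise. For $\gamma\ge 0$ put $P(\gamma)=\operatorname{Tr}[\rho\{\rho\le\gamma\sigma\}]$ and $Q(\gamma)=\operatorname{Tr}[\sigma\{\rho\le\gamma\sigma\}]$. Then $D(\rho\Vert\sigma)$ is finite and $$D(\rho\Vert\sigma)=-\int_0^\infty\log\gamma\,\mathrm{d}\operatorname{Tr}[\rho\{\rho>\gamma\sigma\}]=\int_0^\infty\log\gamma\,\mathrm{d}P(\gamma)$$ $$\phantom{D(\rho\Vert\sigma)}=-\int_0^\infty\gamma\log\gamma\,\mathrm{d}\operatorname{Tr}[\sigma\{\rho>\gamma\sigma\}]=\int_0^\infty\gamma\log\gamma\,\mathrm{d}Q(\gamma).$$ -/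

import Mathlib

open Filter Topology
open scoped ComplexOrder

noncomputable section

namespace QuantumRS

section Integral

variable {E : Type*} [AddCommGroup E] [Module ℝ E] [TopologicalSpace E]

/-- `HasRSIntegral g F a b I`: the Riemann--Stieltjes integral `∫ g dF` over the compact interval
`[a, b]` exists and equals `I`. That is, the sums `∑ g(ξᵢ) (F(xᵢ₊₁) - F(xᵢ))` over all tagged
partitions `a = x₀ ≤ x₁ ≤ ⋯ ≤ x_N = b`, `ξᵢ ∈ [xᵢ, xᵢ₊₁]`, converge to `I` as the mesh tends
to `0`. The integrator `F` may be vector valued (e.g. matrix valued). -/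
def HasRSIntegral (g : ℝ → ℝ) (F : ℝ → E) (a b : ℝ) (I : E) : Prop :=
  ∀ U ∈ 𝓝 I, ∃ δ : ℝ, 0 < δ ∧
    ∀ (N : ℕ) (x ξ : ℕ → ℝ), x 0 = a → x N = b →
      (∀ i < N, x i ≤ x (i + 1)) →
      (∀ i < N, x (i + 1) - x i < δ) →
      (∀ i < N, ξ i ∈ Set.Icc (x i) (x (i + 1))) →
      ∑ i ∈ Finset.range N, g (ξ i) • (F (x (i + 1)) - F (x i)) ∈ U

/-- `∫₀^∞ g dF = I` as a Riemann--Stieltjes integral that is improper at both ends: `∫ g dF` exists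
over `[a, b]` for all `0 < a < b`, and tends to `I` as `a ↓ 0` and `b → ∞` (independently). This is
the meaning of the integral for an integrand that is singular at `0`, such as `log`. -/
def HasRSIntegralIoi (g : ℝ → ℝ) (F : ℝ → E) (I : E) : Prop :=
  ∃ J : ℝ → ℝ → E,
    (∀ a b : ℝ, 0 < a → a < b → HasRSIntegral g F a b (J a b)) ∧
    Tendsto (fun p : ℝ × ℝ => J p.1 p.2) (𝓝[>] (0 : ℝ) ×ˢ atTop) (𝓝 I)

/-- `∫₀^∞ g dF = I` as a Riemann--Stieltjes integral that is improper only at `∞`: `∫ g dF` exists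
over `[0, b]` for all `b > 0`, and tends to `I` as `b → ∞`. This is the meaning of the integral for
an integrand that is continuous on `[0, ∞)`, such as `γ log γ` (with value `0` at `γ = 0`). -/
def HasRSIntegralIci (g : ℝ → ℝ) (F : ℝ → E) (I : E) : Prop :=
  ∃ J : ℝ → E,
    (∀ b : ℝ, 0 < b → HasRSIntegral g F 0 b (J b)) ∧ Tendsto J atTop (𝓝 I)

end Integral

section Operators

variable {n : Type*} [Fintype n] [DecidableEq n]

/-- The spectral projection `{A > B}` of Hermitian matrices: the orthogonal projection onto the
span of the eigenvectors of `A - B` with positive eigenvalue, `1_{(0, ∞)}(A - B)`. -/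
def projGT (A B : Matrix n n ℂ) : Matrix n n ℂ :=
  cfc (Set.indicator (Set.Ioi (0 : ℝ)) (fun _ => (1 : ℝ))) (A - B)

/-- The spectral projection `{A ≤ B}` of Hermitian matrices: the orthogonal projection onto the
span of the eigenvectors of `A - B` with nonpositive eigenvalue, `1_{(-∞, 0]}(A - B)`. -/
def projLE (A B : Matrix n n ℂ) : Matrix n n ℂ :=
  cfc (Set.indicator (Set.Iic (0 : ℝ)) (fun _ => (1 : ℝ))) (A - B)

/-- The (natural) logarithm of a positive semidefinite matrix by functional calculus. Since
`Real.log 0 = 0`, for a singular matrix it is the logarithm taken on the support and extended by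
`0` on the kernel; this is the usual convention in relative entropies. -/
def matLog (A : Matrix n n ℂ) : Matrix n n ℂ :=
  cfc Real.log A

/-- A quantum state (density matrix). -/
def IsState (ρ : Matrix n n ℂ) : Prop :=
  ρ.PosSemidef ∧ ρ.trace = 1

/-- The max-relative entropy `D_max(ρ‖σ) = inf {l : ρ ≤ e^l σ}`, which is `⊤` if there is no
such `l`. -/
def dMax (ρ σ : Matrix n n ℂ) : EReal :=
  sInf ((fun l : ℝ => (l : EReal)) '' {l : ℝ | (Real.exp l • σ - ρ).PosSemidef})

open Classical in
/-- Umegaki's relative entropy: `D(ρ‖σ) = Tr[ρ (log ρ - log σ)]` (a real number) if the support of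
`ρ` is contained in that of `σ`, and `D(ρ‖σ) = ∞` otherwise. -/
def relEntropy (ρ σ : Matrix n n ℂ) : EReal :=
  if LinearMap.range ρ.mulVecLin ≤ LinearMap.range σ.mulVecLin then
    (((ρ * (matLog ρ - matLog σ)).trace.re : ℝ) : EReal)
  else ⊤

/-- `P(γ) = Tr[ρ {ρ ≤ γ σ}]`. -/
def distP (ρ σ : Matrix n n ℂ) (γ : ℝ) : ℝ :=
  (ρ * projLE ρ (γ • σ)).trace.re

/-- `Q(γ) = Tr[σ {ρ ≤ γ σ}]`. -/
def distQ (ρ σ : Matrix n n ℂ) (γ : ℝ) : ℝ :=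
  (σ * projLE ρ (γ • σ)).trace.re

/-- `Tr[ρ {ρ > γ σ}]`. -/
def tailP (ρ σ : Matrix n n ℂ) (γ : ℝ) : ℝ :=
  (ρ * projGT ρ (γ • σ)).trace.re

/-- `Tr[σ {ρ > γ σ}]`. -/
def tailQ (ρ σ : Matrix n n ℂ) (γ : ℝ) : ℝ :=
  (σ * projGT ρ (γ • σ)).trace.re

end Operators

end QuantumRS

end

/-! Write `N(γ) = Tr (A - γB)₋`. Both parts follow from Frenkel's formula: if `aB ≤ A ≤ cB` with `a
> 0`, then `∫ γ⁻¹ N(γ) dγ` over `[a, c]` equals `Tr A log A - Tr A log B - log c · Tr A + c Tr B -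
Tr A`. Let `G(A)` be the difference of the two sides (`frenkelGap`).

The formula `G = 0` is proved by a symmetry argument. `N` is convex in `A`, with `-{A ≤ γB}` as a
subgradient, so `G` can be differentiated along `A + xH` (`hasDerivAt_frenkelGap`). For `H = 1` the
derivative vanishes: by Sylvester's law `Tr {A ≤ γB}` counts the eigenvalues of `B^{-1/2} A
B^{-1/2}` that are at most `γ`, and the weighted integral of this count is a log-determinant. Hence
`G(A + 1) = G(A)`. `G` is also homogeneous of degree one, so `G(1 + εA) = G(εA) = ε G(A)`. At the
base point `1` everything commutes with `B`, and the derivative of `G` in direction `A` is computed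
to be `0`. Comparing the two derivatives gives `G(A) = 0` (`frenkelGap_eq_zero_of_bounds`).

Part (1): differentiating `G = 0` in every Hermitian direction `H` gives a matrix identity for `∫
γ⁻¹ {A ≤ γB} dγ` (`integral_inv_smul_projNonpos`). Integration by parts
(`hasRSIntegral_of_ae_continuousAt`) turns it into the integral of `log γ` against `{A > γB}`.

Part (2): finiteness of `D_max` gives `ρ ≤ cσ`. Frenkel's formula passes to this singular case by
adding `t • 1` to both states and letting `t ↓ 0` (`integral_negTrace_of_posSemidef`). Since `N = γQ
- P` and `N' = Q` off a countable set, integrating by parts expresses the integrals against `P` and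
`Q` through `∫ γ⁻¹ N`. The tails are `1 - P` and `1 - Q`, which only changes the sign. -/

namespace QuantumRS

open MeasureTheory

/-! ### Convex differentiation and Riemann–Stieltjes integration by parts -/

section Calculus

/-- A function with a subgradient that is continuous at a point is differentiable there. -/
theorem hasDerivAt_of_subgradient {f q : ℝ → ℝ} {x₀ : ℝ}
    (h₁ : ∀ᶠ y in 𝓝 x₀, f x₀ + (y - x₀) * q x₀ ≤ f y)
    (h₂ : ∀ᶠ y in 𝓝 x₀, f y + (x₀ - y) * q y ≤ f x₀)
    (hq : ContinuousAt q x₀) : HasDerivAt f (q x₀) x₀ := by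
  rw [hasDerivAt_iff_isLittleO]
  -- The two subgradient inequalities squeeze the first-order remainder between `0` and `(y - x₀) *
  -- (q y - q x₀)`, which is `o(y - x₀)` by continuity of `q`.
  have h3 : (fun y => (y - x₀) * (q y - q x₀)) =o[𝓝 x₀] fun y => y - x₀ := by
    have : (fun y => q y - q x₀) =o[𝓝 x₀] fun _ => (1 : ℝ) := by
      rw [Asymptotics.isLittleO_one_iff]
      simpa using hq.tendsto.sub_const (q x₀)
    simpa using (Asymptotics.isBigO_refl (fun y => y - x₀) (𝓝 x₀)).mul_isLittleO this
  refine Asymptotics.IsBigO.trans_isLittleO (Asymptotics.IsBigO.of_bound 1 ?_) h3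
  filter_upwards [h₁, h₂] with y hy₁ hy₂
  rw [one_mul, Real.norm_eq_abs, Real.norm_eq_abs, smul_eq_mul]
  have ha : 0 ≤ f y - f x₀ - (y - x₀) * q x₀ := by linarith
  rw [abs_of_nonneg ha]
  refine le_trans ?_ (le_abs_self _)
  linarith

variable {E : Type*} [NormedAddCommGroup E]

/-- The step function with value `y i` on `(η i, η (i + 1)]`, for `i < m`. -/
noncomputable def stepFun (η : ℕ → ℝ) (y : ℕ → E) (m : ℕ) (t : ℝ) : E :=
  ∑ i ∈ Finset.range m, (Set.Ioc (η i) (η (i + 1))).indicator (fun _ => y i) t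

theorem stepFun_eq_zero {η : ℕ → ℝ} {y : ℕ → E} {m : ℕ}
    (hη : ∀ i < m, η i ≤ η (i + 1)) {t : ℝ} (ht : η m < t) : stepFun η y m t = 0 := by
  induction m with
  | zero => simp [stepFun]
  | succ m ih =>
    rw [stepFun, Finset.sum_range_succ, ← stepFun,
      ih (fun i hi => hη i (by omega)) ((hη m (by omega)).trans_lt ht),
      Set.indicator_of_notMem (fun h => absurd h.2 (not_le.mpr ht)), add_zero]

theorem exists_stepFun_eq {η : ℕ → ℝ} {y : ℕ → E} {m : ℕ}
    (hη : ∀ i < m, η i ≤ η (i + 1)) {t : ℝ} (ht : t ∈ Set.Ioc (η 0) (η m)) :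
    ∃ i < m, t ∈ Set.Ioc (η i) (η (i + 1)) ∧ stepFun η y m t = y i := by
  induction m with
  | zero => exact absurd ht (by simp)
  | succ m ih =>
    by_cases h : t ≤ η m
    · obtain ⟨i, hi, hti, hs⟩ := ih (fun i hi => hη i (by omega)) ⟨ht.1, h⟩
      refine ⟨i, by omega, hti, ?_⟩
      rw [stepFun, Finset.sum_range_succ, ← stepFun, hs,
        Set.indicator_of_notMem (fun h' => absurd h'.1 (not_lt.mpr h)), add_zero]
    · push Not at h
      refine ⟨m, by omega, ⟨h, ht.2⟩, ?_⟩
      rw [stepFun, Finset.sum_range_succ, ← stepFun,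
        stepFun_eq_zero (fun i hi => hη i (by omega)) h, zero_add]
      exact Set.indicator_of_mem (s := Set.Ioc (η m) (η (m + 1))) ⟨h, ht.2⟩ _

theorem stronglyMeasurable_stepFun (η : ℕ → ℝ) (y : ℕ → E) (m : ℕ) :
    StronglyMeasurable (stepFun η y m) := by
  have : stepFun η y m = ∑ i ∈ Finset.range m,
      (Set.Ioc (η i) (η (i + 1))).indicator (fun _ => y i) := by
    ext t; simp [stepFun]
  rw [this]
  exact Finset.stronglyMeasurable_sum _ fun i _ =>
    stronglyMeasurable_const.indicator measurableSet_Ioc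

theorem le_of_forall_lt_succ {η : ℕ → ℝ} {m : ℕ} (hη : ∀ i < m, η i ≤ η (i + 1)) {i j : ℕ}
    (hij : i ≤ j) (hj : j ≤ m) : η i ≤ η j := by
  induction j, hij using Nat.le_induction with
  | base => exact le_rfl
  | succ j _ ih => exact (ih (by omega)).trans (hη j (by omega))

variable [NormedSpace ℝ E]

theorem sum_sub_smul_eq_integral_stepFun [CompleteSpace E] {g g' : ℝ → ℝ} {a b : ℝ}
    (hg' : IntervalIntegrable g' volume a b)
    (hg : ∀ s ∈ Set.Icc a b, ∀ t ∈ Set.Icc a b, ∫ u in s..t, g' u = g t - g s)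
    {η : ℕ → ℝ} {y : ℕ → E} {m : ℕ}
    (hη : ∀ i < m, η i ≤ η (i + 1)) (h0 : η 0 = a) (hm : η m = b) :
    ∑ i ∈ Finset.range m, (g (η (i + 1)) - g (η i)) • y i
      = ∫ t in a..b, g' t • stepFun η y m t := by
  have hab : a ≤ b := by
    rw [← h0, ← hm]; exact le_of_forall_lt_succ hη (Nat.zero_le _) le_rfl
  have hmem : ∀ i ≤ m, η i ∈ Set.Icc a b := fun i hi =>
    ⟨h0 ▸ le_of_forall_lt_succ hη (Nat.zero_le _) hi, hm ▸ le_of_forall_lt_succ hη hi le_rfl⟩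
  have hint : ∀ i, IntegrableOn (fun t => (Set.Ioc (η i) (η (i + 1))).indicator
      (fun t => g' t • y i) t) (Set.Ioc a b) volume := fun i =>
    Integrable.indicator (((intervalIntegrable_iff_integrableOn_Ioc_of_le hab).mp hg').smul_const _)
      measurableSet_Ioc
  have hrw : ∀ t, g' t • stepFun η y m t = ∑ i ∈ Finset.range m,
      (Set.Ioc (η i) (η (i + 1))).indicator (fun t => g' t • y i) t := by
    intro t
    rw [stepFun, Finset.smul_sum]
    refine Finset.sum_congr rfl fun i _ => ?_
    by_cases h : t ∈ Set.Ioc (η i) (η (i + 1)) <;> simp [h]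
  simp only [hrw]
  rw [intervalIntegral.integral_of_le hab, integral_finsetSum _ fun i _ => hint i]
  refine Finset.sum_congr rfl fun i hi => ?_
  rw [Finset.mem_range] at hi
  have h1 := hmem i hi.le
  have h2 := hmem (i + 1) hi
  rw [setIntegral_indicator measurableSet_Ioc, Set.inter_eq_right.mpr, ← hg _ h1 _ h2,
    integral_smul_const, intervalIntegral.integral_of_le (hη i hi)]
  exact Set.Ioc_subset_Ioc h1.1 h2.2

/-- The interlaced partition `a, ξ 0, …, ξ (N - 1), b`. -/
noncomputable def interlace (ξ : ℕ → ℝ) (a b : ℝ) (N : ℕ) : ℕ → ℝ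
  | 0 => a
  | i + 1 => if i < N then ξ i else b

/-- Abel summation swaps the roles of tags and nodes: the tags `ξ`, framed by `a` and `b`, become
the partition for `g`, and the old nodes become the points where `F` is sampled. This gives `N + 1`
cells, some possibly degenerate. -/
theorem sum_smul_sub_by_parts (g : ℝ → ℝ) (F : ℕ → E) (ξ : ℕ → ℝ) (a b : ℝ) (N : ℕ) :
    ∑ i ∈ Finset.range N, g (ξ i) • (F (i + 1) - F i) =
      g b • F N - g a • F 0 - ∑ i ∈ Finset.range (N + 1),
        (g (interlace ξ a b N (i + 1)) - g (interlace ξ a b N i)) • F i := by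
  rw [Finset.sum_range_succ]
  have key : ∀ m ≤ N, ∑ i ∈ Finset.range m, g (ξ i) • (F (i + 1) - F i)
      = g (interlace ξ a b N m) • F m - g a • F 0 - ∑ i ∈ Finset.range m,
        (g (interlace ξ a b N (i + 1)) - g (interlace ξ a b N i)) • F i := by
    intro m hm
    induction m with
    | zero => simp [interlace]
    | succ m ih =>
      have hlt : m < N := hm
      rw [Finset.sum_range_succ, Finset.sum_range_succ, ih hlt.le]
      have : interlace ξ a b N (m + 1) = ξ m := by simp [interlace, hlt]
      rw [this]
      module
  rw [key N le_rfl]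
  have : interlace ξ a b N (N + 1) = b := by simp [interlace]
  rw [this]
  module

/-- Integration by parts: the Riemann--Stieltjes integral of an absolutely continuous function
against a bounded and almost everywhere continuous integrator. -/
theorem hasRSIntegral_of_ae_continuousAt [CompleteSpace E] {g g' : ℝ → ℝ} {F : ℝ → E} {a b C : ℝ}
    (hab : a < b) (hg' : IntervalIntegrable g' volume a b)
    (hg : ∀ s ∈ Set.Icc a b, ∀ t ∈ Set.Icc a b, ∫ u in s..t, g' u = g t - g s)
    (hFb : ∀ t ∈ Set.Icc a b, ‖F t‖ ≤ C)
    (hFc : ∀ᵐ t, t ∈ Set.Ioc a b → ContinuousAt F t) :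
    HasRSIntegral g F a b (g b • F b - g a • F a - ∫ t in a..b, g' t • F t) := by
  intro U hU
  by_contra! hcon
  have hC : 0 ≤ C := (norm_nonneg _).trans (hFb a ⟨le_rfl, hab.le⟩)
  -- If convergence fails, there is a bad tagged partition for each mesh bound `1 / (k + 1)`. A
  -- sequence of partitions is enough for dominated convergence.
  choose N x ξ hx0 hxN hmono hmesh hξ hout using
    fun k : ℕ => hcon (1 / ((k : ℝ) + 1)) (by positivity)
  let η : ℕ → ℕ → ℝ := fun k => interlace (ξ k) a b (N k)
  have hmem : ∀ k, ∀ i ≤ N k, x k i ∈ Set.Icc a b := fun k i hi =>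
    ⟨hx0 k ▸ le_of_forall_lt_succ (hmono k) (Nat.zero_le _) hi,
      hxN k ▸ le_of_forall_lt_succ (hmono k) hi le_rfl⟩
  -- Node `x k i` lies in the cell from `η k i` to `η k (i + 1)`, and both ends are within the mesh
  -- bound. So the step function `S k` samples `F` within `1 / (k + 1)` of `t`, and converges
  -- wherever `F` is continuous.
  have hηlo : ∀ k, ∀ i ≤ N k, x k i - 1 / ((k : ℝ) + 1) ≤ η k i ∧ η k i ≤ x k i := by
    intro k i hi
    cases i with
    | zero =>
      have : (0 : ℝ) ≤ 1 / ((k : ℝ) + 1) := by positivity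
      simp only [η, interlace, hx0]; constructor <;> linarith
    | succ i =>
      have hi' : i < N k := hi
      have h1 := hξ k i hi'
      have h2 := hmesh k i hi'
      simp only [η, interlace, hi', if_true]
      exact ⟨by linarith [h1.1], h1.2⟩
  have hηhi : ∀ k, ∀ i ≤ N k, x k i ≤ η k (i + 1) ∧
      η k (i + 1) ≤ x k i + 1 / ((k : ℝ) + 1) := by
    intro k i hi
    rcases hi.lt_or_eq with hi' | rfl
    · have h1 := hξ k i hi'
      have h2 := hmesh k i hi'
      simp only [η, interlace, hi', if_true]
      exact ⟨h1.1, by linarith [h1.2]⟩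
    · have : (0 : ℝ) ≤ 1 / ((k : ℝ) + 1) := by positivity
      simp only [η, interlace, hxN, lt_irrefl, if_false]; constructor <;> linarith
  have hηmono : ∀ k, ∀ i < N k + 1, η k i ≤ η k (i + 1) := fun k i hi =>
    (hηlo k i (by omega)).2.trans (hηhi k i (by omega)).1
  have hη0 : ∀ k, η k 0 = a := fun k => rfl
  have hηN : ∀ k, η k (N k + 1) = b := fun k => by simp [η, interlace]
  let S : ℕ → ℝ → E := fun k => stepFun (η k) (fun i => F (x k i)) (N k + 1)
  have hS : ∀ k : ℕ, ∀ t ∈ Set.Ioc a b, ∃ z ∈ Set.Icc a b, |z - t| ≤ 1 / ((k : ℝ) + 1) ∧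
      S k t = F z := by
    intro k t ht
    obtain ⟨i, hi, hti, hs⟩ := exists_stepFun_eq (y := fun i => F (x k i)) (hηmono k)
      (t := t) (by rw [hη0, hηN]; exact ht)
    refine ⟨x k i, hmem k i (by omega), ?_, hs⟩
    have h1 := hηlo k i (by omega)
    have h2 := hηhi k i (by omega)
    rw [abs_le]
    constructor <;> linarith [hti.1, hti.2]
  have hlim : Tendsto (fun k => ∫ t in a..b, g' t • S k t) atTop
      (𝓝 (∫ t in a..b, g' t • F t)) := by
    refine intervalIntegral.tendsto_integral_filter_of_dominated_convergence
      (fun t => ‖g' t‖ * C) (Eventually.of_forall fun k => ?_) (Eventually.of_forall fun k => ?_)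
      (hg'.norm.mul_const C) ?_
    · rw [Set.uIoc_of_le hab.le]
      have h := ((intervalIntegrable_iff_integrableOn_Ioc_of_le hab.le).mp hg').aestronglyMeasurable
      exact h.smul (stronglyMeasurable_stepFun _ _ _).aestronglyMeasurable
    · refine Eventually.of_forall fun t ht => ?_
      rw [Set.uIoc_of_le hab.le] at ht
      obtain ⟨z, hz, -, hSz⟩ := hS k t ht
      rw [hSz, norm_smul]
      exact mul_le_mul_of_nonneg_left (hFb z hz) (norm_nonneg _)
    · filter_upwards [hFc] with t hcont ht
      rw [Set.uIoc_of_le hab.le] at ht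
      choose z _ hz2 hz3 using fun k => hS k t ht
      simp only [hz3]
      refine Tendsto.const_smul ?_ _
      refine (hcont ht).tendsto.comp ?_
      rw [tendsto_iff_dist_tendsto_zero]
      exact squeeze_zero (fun _ => dist_nonneg) (fun k => hz2 k)
        tendsto_one_div_add_atTop_nhds_zero_nat
  have hsum : ∀ k, ∑ i ∈ Finset.range (N k), g (ξ k i) • (F (x k (i + 1)) - F (x k i))
      = g b • F b - g a • F a - ∫ t in a..b, g' t • S k t := by
    intro k
    rw [sum_smul_sub_by_parts g (fun i => F (x k i)) (ξ k) a b (N k), hx0, hxN,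
      ← sum_sub_smul_eq_integral_stepFun hg' hg (hηmono k) (hη0 k) (hηN k)]
  obtain ⟨k, hk⟩ := ((tendsto_const_nhds.sub hlim).eventually hU).exists
  exact hout k (hsum k ▸ hk)

theorem HasRSIntegral.const_sub {E : Type*} [AddCommGroup E] [Module ℝ E] [TopologicalSpace E]
    [ContinuousNeg E] {g : ℝ → ℝ} {F : ℝ → E} {a b : ℝ} {I : E}
    (h : HasRSIntegral g F a b I) (k : E) : HasRSIntegral g (fun t => k - F t) a b (-I) := by
  intro U hU
  obtain ⟨δ, hδ, H⟩ := h _ (continuous_neg.continuousAt.preimage_mem_nhds hU)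
  refine ⟨δ, hδ, fun N x ξ h0 hN h1 h2 h3 => ?_⟩
  have := H N x ξ h0 hN h1 h2 h3
  rw [Set.mem_preimage, ← Finset.sum_neg_distrib] at this
  convert this using 3
  module

theorem HasRSIntegralIoi.const_sub {E : Type*} [AddCommGroup E] [Module ℝ E] [TopologicalSpace E]
    [ContinuousNeg E] {g : ℝ → ℝ} {F : ℝ → E} {I : E}
    (h : HasRSIntegralIoi g F I) (k : E) : HasRSIntegralIoi g (fun t => k - F t) (-I) := by
  obtain ⟨J, hJ, hlim⟩ := h
  exact ⟨fun a b => -J a b, fun a b ha hab => (hJ a b ha hab).const_sub k, hlim.neg⟩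

theorem HasRSIntegralIci.const_sub {E : Type*} [AddCommGroup E] [Module ℝ E] [TopologicalSpace E]
    [ContinuousNeg E] {g : ℝ → ℝ} {F : ℝ → E} {I : E}
    (h : HasRSIntegralIci g F I) (k : E) : HasRSIntegralIci g (fun t => k - F t) (-I) := by
  obtain ⟨J, hJ, hlim⟩ := h
  exact ⟨fun b => -J b, fun b hb => (hJ b hb).const_sub k, hlim.neg⟩

end Calculus

/-! ### Trace formulas, Klein's inequality and the negative part -/

section Spectral

variable {n : Type*} [Fintype n] [DecidableEq n]

/-- The spectrum is finite, so every function is admissible for the functional calculus, including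
the discontinuous indicators that define the projections. -/
theorem continuousOn_spectrum (f : ℝ → ℝ) (X : Matrix n n ℂ) :
    ContinuousOn f (spectrum ℝ X) :=
  (Matrix.finite_real_spectrum (A := X)).continuousOn f

theorem cfc_one_hermitian {X : Matrix n n ℂ} (hX : X.IsHermitian) :
    cfc (fun _ : ℝ => (1 : ℝ)) X = 1 :=
  cfc_const_one ℝ X (ha := hX.isSelfAdjoint)

theorem cfc_id_hermitian {X : Matrix n n ℂ} (hX : X.IsHermitian) :
    cfc (fun x : ℝ => x) X = X :=
  cfc_id' ℝ X hX.isSelfAdjoint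

/-- The diagonal of `H` in an eigenbasis of `X`. -/
noncomputable def specWeight {X : Matrix n n ℂ} (hX : X.IsHermitian) (H : Matrix n n ℂ) (i : n) :
    ℝ :=
  ((star (hX.eigenvectorUnitary : Matrix n n ℂ) * H * hX.eigenvectorUnitary) i i).re

theorem trace_mul_cfc {X : Matrix n n ℂ} (hX : X.IsHermitian) (H : Matrix n n ℂ) (f : ℝ → ℝ) :
    (H * cfc f X).trace.re = ∑ i, specWeight hX H i * f (hX.eigenvalues i) := by
  rw [hX.cfc_eq, Matrix.IsHermitian.cfc, Unitary.conjStarAlgAut_apply, ← Matrix.mul_assoc,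
    Matrix.trace_mul_comm, ← Matrix.mul_assoc, ← Matrix.mul_assoc, Matrix.trace, Complex.re_sum]
  refine Finset.sum_congr rfl fun i _ => ?_
  rw [Matrix.diag_apply, Matrix.mul_diagonal, Function.comp_apply, Function.comp_apply, specWeight]
  simp

theorem specWeight_nonneg {X : Matrix n n ℂ} (hX : X.IsHermitian) {H : Matrix n n ℂ}
    (hH : H.PosSemidef) (i : n) : 0 ≤ specWeight hX H i :=
  (Complex.nonneg_iff.mp ((hH.conjTranspose_mul_mul_same
    (hX.eigenvectorUnitary : Matrix n n ℂ)).diag_nonneg (i := i))).1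

theorem sum_specWeight {X : Matrix n n ℂ} (hX : X.IsHermitian) (H : Matrix n n ℂ) :
    ∑ i, specWeight hX H i = H.trace.re := by
  have h := trace_mul_cfc hX H (fun _ => 1)
  rw [cfc_one_hermitian hX] at h
  simpa using h.symm

theorem specWeight_one {X : Matrix n n ℂ} (hX : X.IsHermitian) (i : n) :
    specWeight hX 1 i = 1 := by
  simp [specWeight]

theorem trace_cfc {X : Matrix n n ℂ} (hX : X.IsHermitian) (f : ℝ → ℝ) :
    (cfc f X).trace.re = ∑ i, f (hX.eigenvalues i) := by
  have h := trace_mul_cfc hX 1 f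
  simpa [specWeight_one] using h

theorem mul_cfc_self {X : Matrix n n ℂ} (hX : X.IsHermitian) (f : ℝ → ℝ) :
    X * cfc f X = cfc (fun x => x * f x) X := by
  rw [cfc_mul (fun x => x) f X (continuousOn_spectrum _ _) (continuousOn_spectrum _ _),
    cfc_id_hermitian hX]

/-- The weights are the squared overlaps of the two eigenbases. They reduce trace inequalities
between noncommuting matrices to scalar inequalities between pairs of eigenvalues. -/
theorem exists_trace_cfc_mul_cfc {X Y : Matrix n n ℂ} (hX : X.IsHermitian) (hY : Y.IsHermitian) :
    ∃ p : n → n → ℝ, (∀ i j, 0 ≤ p i j) ∧ ∀ g h : ℝ → ℝ, (cfc g Y * cfc h X).trace.re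
      = ∑ i, ∑ j, p i j * (g (hY.eigenvalues j) * h (hX.eigenvalues i)) := by
  let W : Matrix n n ℂ :=
    star (hX.eigenvectorUnitary : Matrix n n ℂ) * (hY.eigenvectorUnitary : Matrix n n ℂ)
  refine ⟨fun i j => Complex.normSq (W i j), fun i j => Complex.normSq_nonneg _, fun g h => ?_⟩
  rw [trace_mul_cfc hX]
  refine Finset.sum_congr rfl fun i _ => ?_
  have h1 : specWeight hX (cfc g Y) i = ∑ j, Complex.normSq (W i j) * g (hY.eigenvalues j) := by
    rw [hY.cfc_eq, Matrix.IsHermitian.cfc, Unitary.conjStarAlgAut_apply, specWeight]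
    have h2 : star (hX.eigenvectorUnitary : Matrix n n ℂ) *
        ((hY.eigenvectorUnitary : Matrix n n ℂ) *
          Matrix.diagonal (RCLike.ofReal ∘ g ∘ hY.eigenvalues) *
          star (hY.eigenvectorUnitary : Matrix n n ℂ)) * (hX.eigenvectorUnitary : Matrix n n ℂ)
        = W * Matrix.diagonal (RCLike.ofReal ∘ g ∘ hY.eigenvalues) * star W := by
      simp only [W, star_mul, star_star, Matrix.mul_assoc]
    rw [h2, Matrix.mul_apply, Complex.re_sum]
    refine Finset.sum_congr rfl fun j _ => ?_
    rw [Matrix.mul_diagonal, Matrix.star_apply, Complex.normSq_apply]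
    simp
    ring
  rw [h1, Finset.sum_mul]
  exact Finset.sum_congr rfl fun j _ => by ring

theorem mul_log_sub_nonneg {x y : ℝ} (hx : 0 < x) (hy : 0 < y) :
    0 ≤ y * Real.log y - y * Real.log x - y + x := by
  have h := Real.log_le_sub_one_of_pos (div_pos hx hy)
  rw [Real.log_div hx.ne' hy.ne'] at h
  have := mul_le_mul_of_nonneg_left h hy.le
  have h2 : y * (x / y - 1) = x - y := by field_simp
  linarith

/-- Klein's inequality for `x log x`. -/
theorem trace_mul_log_klein {X Y : Matrix n n ℂ} (hX : X.PosDef) (hY : Y.PosDef) :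
    (X * matLog X).trace.re + ((Y - X) * (matLog X + 1)).trace.re ≤ (Y * matLog Y).trace.re := by
  obtain ⟨p, hp, hpe⟩ := exists_trace_cfc_mul_cfc hX.1 hY.1
  have e1 := hpe (fun y => y * Real.log y) (fun _ => 1)
  have e2 := hpe (fun y => y) Real.log
  have e3 := hpe (fun y => y) (fun _ => 1)
  have e4 := hpe (fun _ => 1) (fun x => x)
  rw [← mul_cfc_self hY.1] at e1
  rw [cfc_id_hermitian hY.1] at e2 e3
  rw [cfc_id_hermitian hX.1] at e4
  rw [cfc_one_hermitian hX.1] at e1 e3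
  rw [cfc_one_hermitian hY.1] at e4
  simp only [mul_one, one_mul] at e1 e2 e3 e4
  have h : ((Y - X) * (matLog X + 1)).trace.re
      = (Y * matLog X).trace.re + Y.trace.re - (X * matLog X).trace.re - X.trace.re := by
    simp only [sub_mul, mul_add, mul_one, Matrix.trace_sub, Matrix.trace_add, Complex.add_re,
      Complex.sub_re]
    ring
  rw [h]
  simp only [matLog]
  rw [e1, e2, e3, e4]
  rw [← sub_nonneg]
  have : 0 ≤ ∑ i, ∑ j, p i j * (hY.1.eigenvalues j * Real.log (hY.1.eigenvalues j) -
      hY.1.eigenvalues j * Real.log (hX.1.eigenvalues i) - hY.1.eigenvalues j +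
      hX.1.eigenvalues i) :=
    Finset.sum_nonneg fun i _ => Finset.sum_nonneg fun j _ => mul_nonneg (hp i j)
      (mul_log_sub_nonneg (hX.eigenvalues_pos i) (hY.eigenvalues_pos j))
  refine this.trans_eq ?_
  simp only [mul_add, mul_sub, Finset.sum_add_distrib, Finset.sum_sub_distrib]
  ring

/-- The spectral projection onto the nonpositive part. -/
noncomputable def projNonpos (X : Matrix n n ℂ) : Matrix n n ℂ :=
  cfc (Set.indicator (Set.Iic (0 : ℝ)) (fun _ => (1 : ℝ))) X

/-- The trace of the negative part. -/
noncomputable def negTrace (X : Matrix n n ℂ) : ℝ :=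
  -(X * projNonpos X).trace.re

theorem projLE_eq (A B : Matrix n n ℂ) : projLE A B = projNonpos (A - B) := rfl

theorem projGT_eq {A B : Matrix n n ℂ} (h : (A - B).IsHermitian) :
    projGT A B = 1 - projNonpos (A - B) := by
  rw [projGT, projNonpos, ← cfc_one_hermitian h,
    ← cfc_sub _ _ _ (continuousOn_spectrum _ _) (continuousOn_spectrum _ _)]
  congr 1
  ext x
  by_cases hx : x ≤ 0
  · simp [hx, not_lt.mpr hx]
  · simp [hx, not_le.mp hx]

theorem isHermitian_projNonpos (X : Matrix n n ℂ) : (projNonpos X).IsHermitian :=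
  cfc_predicate (R := ℝ) (p := IsSelfAdjoint) _ X

theorem indicator_Iic_nonneg (x : ℝ) :
    0 ≤ Set.indicator (Set.Iic (0 : ℝ)) (fun _ => (1 : ℝ)) x :=
  Set.indicator_nonneg (fun _ _ => zero_le_one) _

theorem indicator_Iic_le_one (x : ℝ) :
    Set.indicator (Set.Iic (0 : ℝ)) (fun _ => (1 : ℝ)) x ≤ 1 :=
  Set.indicator_le_self' (fun _ _ => zero_le_one) _

theorem trace_mul_projNonpos_nonneg {X H : Matrix n n ℂ} (hX : X.IsHermitian)
    (hH : H.PosSemidef) : 0 ≤ (H * projNonpos X).trace.re := by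
  rw [projNonpos, trace_mul_cfc hX]
  exact Finset.sum_nonneg fun i _ => mul_nonneg (specWeight_nonneg hX hH i)
    (indicator_Iic_nonneg _)

theorem trace_mul_projNonpos_le {X H : Matrix n n ℂ} (hX : X.IsHermitian)
    (hH : H.PosSemidef) : (H * projNonpos X).trace.re ≤ H.trace.re := by
  rw [projNonpos, trace_mul_cfc hX, ← sum_specWeight hX]
  exact Finset.sum_le_sum fun i _ => mul_le_of_le_one_right (specWeight_nonneg hX hH i)
    (indicator_Iic_le_one _)

theorem negTrace_eq_sum {X : Matrix n n ℂ} (hX : X.IsHermitian) :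
    negTrace X = ∑ i, max (-hX.eigenvalues i) 0 := by
  rw [negTrace, projNonpos, mul_cfc_self hX, trace_cfc hX, ← Finset.sum_neg_distrib]
  refine Finset.sum_congr rfl fun i _ => ?_
  by_cases h : hX.eigenvalues i ≤ 0
  · simp [h]
  · simp [h, (not_le.mp h).le]

theorem negTrace_nonneg {X : Matrix n n ℂ} (hX : X.IsHermitian) : 0 ≤ negTrace X := by
  rw [negTrace_eq_sum hX]
  exact Finset.sum_nonneg fun i _ => le_max_right _ _

/-- Variational principle: weighting the eigenvalues of `X` by numbers in `[0, 1]` gives the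
smallest total when exactly the nonpositive ones are kept. Only spectral projections of another
matrix are needed as competitors. -/
theorem neg_trace_mul_projNonpos_le {X Y : Matrix n n ℂ} (hX : X.IsHermitian)
    (hY : Y.IsHermitian) : -(X * projNonpos Y).trace.re ≤ negTrace X := by
  obtain ⟨p, hp, hpe⟩ := exists_trace_cfc_mul_cfc hY hX
  set f := Set.indicator (Set.Iic (0 : ℝ)) (fun _ => (1 : ℝ)) with hf
  have e1 := hpe (fun x => x) f
  have e2 := hpe (fun x => x * f x) (fun _ => 1)
  rw [cfc_id_hermitian hX] at e1
  rw [← mul_cfc_self hX, cfc_one_hermitian hY, mul_one] at e2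
  rw [negTrace, projNonpos, projNonpos, ← hf, e1, e2, neg_le_neg_iff]
  refine Finset.sum_le_sum fun i _ => Finset.sum_le_sum fun j _ =>
    mul_le_mul_of_nonneg_left ?_ (hp i j)
  rw [mul_one]
  have h0 := indicator_Iic_nonneg (hY.eigenvalues i)
  have h1 := indicator_Iic_le_one (hY.eigenvalues i)
  by_cases h : hX.eigenvalues j ≤ 0
  · have : f (hX.eigenvalues j) = 1 := by simp [hf, h]
    rw [this]
    nlinarith
  · have : f (hX.eigenvalues j) = 0 := by simp [hf, h]
    rw [this, mul_zero]
    exact mul_nonneg (not_le.mp h).le h0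

/-- Using the projection of `X` as a competitor for `Y` shows that `-projNonpos X` is a subgradient
of the convex function `negTrace` at `X`. All later derivatives of `negTrace` come from this. -/
theorem negTrace_add_le {X Y : Matrix n n ℂ} (hX : X.IsHermitian) (hY : Y.IsHermitian) :
    negTrace X - ((Y - X) * projNonpos X).trace.re ≤ negTrace Y := by
  have h := neg_trace_mul_projNonpos_le hY hX
  rw [sub_mul, Matrix.trace_sub, Complex.sub_re, negTrace]
  linarith

theorem projNonpos_of_posDef {X : Matrix n n ℂ} (hX : X.PosDef) : projNonpos X = 0 := by
  rw [projNonpos, ← cfc_const_zero ℝ X]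
  refine cfc_congr fun x hx => ?_
  rw [hX.1.spectrum_real_eq_range_eigenvalues] at hx
  obtain ⟨i, rfl⟩ := hx
  simp [hX.eigenvalues_pos i]

theorem projNonpos_of_neg {X : Matrix n n ℂ} (hX : (-X).PosSemidef) : projNonpos X = 1 := by
  have hX' : X.IsHermitian := by simpa using hX.1.neg
  rw [projNonpos, ← cfc_one_hermitian hX']
  refine cfc_congr fun x hx => ?_
  rw [hX'.spectrum_real_eq_range_eigenvalues] at hx
  obtain ⟨i, rfl⟩ := hx
  have : hX'.eigenvalues i ≤ 0 := by
    have h := hX.re_dotProduct_nonneg (hX'.eigenvectorBasis i)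
    rw [hX'.eigenvalues_eq i]
    rw [Matrix.neg_mulVec, dotProduct_neg] at h
    simpa using h
  simp [this]

theorem negTrace_of_posSemidef {X : Matrix n n ℂ} (hX : X.PosSemidef) : negTrace X = 0 := by
  rw [negTrace_eq_sum hX.1]
  exact Finset.sum_eq_zero fun i _ => max_eq_right (neg_nonpos.mpr (hX.eigenvalues_nonneg i))

theorem projNonpos_smul {X : Matrix n n ℂ} (hX : X.IsHermitian) {t : ℝ} (ht : 0 < t) :
    projNonpos (t • X) = projNonpos X := by
  have hX' : IsSelfAdjoint X := hX
  rw [projNonpos, projNonpos, ← cfc_comp_smul t _ X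
    ((Set.Finite.image _ (Matrix.finite_real_spectrum (A := X))).continuousOn _)]
  congr 1
  ext x
  have : t * x ≤ 0 ↔ x ≤ 0 := by
    constructor
    · intro h; by_contra! hx; nlinarith [mul_pos ht hx]
    · intro h; nlinarith
  by_cases hx : x ≤ 0
  · simp [hx, this.mpr hx]
  · simp [hx, this]

theorem negTrace_smul {X : Matrix n n ℂ} (hX : X.IsHermitian) {t : ℝ} (ht : 0 < t) :
    negTrace (t • X) = t * negTrace X := by
  rw [negTrace, negTrace, projNonpos_smul hX ht]
  simp

end Spectral

/-! ### Continuity of the functional calculus in the matrix -/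

section Continuity

variable {n : Type*} [Fintype n] [DecidableEq n]

open scoped Matrix.Norms.L2Operator in
-- By upper hemicontinuity of the spectrum, nearby matrices have spectrum in one compact subset of
-- `s`, so continuity of `f` on `s` suffices.
theorem tendsto_cfc_of_isOpen {ι : Type*} {l : Filter ι} {a : ι → Matrix n n ℂ}
    {a₀ : Matrix n n ℂ} {f : ℝ → ℝ} {s : Set ℝ} (hs : IsOpen s) (hf : ContinuousOn f s)
    (ha : Tendsto a l (𝓝 a₀)) (hH : ∀ᶠ t in l, (a t).IsHermitian) (h₀ : a₀.IsHermitian)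
    (hsp : spectrum ℝ a₀ ⊆ s) :
    Tendsto (fun t => cfc f (a t)) l (𝓝 (cfc f a₀)) := by
  obtain ⟨S, ⟨hS₁, hS₂⟩, hS₃⟩ :=
    (spectrum.isCompact (𝕜 := ℝ) a₀).nhdsSet_basis_isCompact.mem_iff.mp
      (hs.mem_nhdsSet.mpr hsp)
  have hev : ∀ᶠ x' in 𝓝 a₀, spectrum ℝ x' ⊆ S :=
    ((upperHemicontinuous_spectrum ℝ (Matrix n n ℂ)).upperHemicontinuousAt a₀ _ hS₁).mono
      fun _ => subset_of_mem_nhdsSet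
  exact Filter.Tendsto.cfc hS₂ f ha (ha.eventually hev) hH (subset_of_mem_nhdsSet hS₁) h₀
    (hf.mono hS₃)

/-- The indicator jumps only at `0`, which an invertible limit keeps out of its spectrum. -/
theorem tendsto_projNonpos {ι : Type*} {l : Filter ι} {a : ι → Matrix n n ℂ}
    {a₀ : Matrix n n ℂ} (ha : Tendsto a l (𝓝 a₀)) (hH : ∀ᶠ t in l, (a t).IsHermitian)
    (h₀ : a₀.IsHermitian) (hu : IsUnit a₀) :
    Tendsto (fun t => projNonpos (a t)) l (𝓝 (projNonpos a₀)) := by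
  refine tendsto_cfc_of_isOpen (s := {0}ᶜ) isOpen_compl_singleton ?_ ha hH h₀ ?_
  · intro x hx
    refine ContinuousAt.continuousWithinAt ?_
    rcases lt_or_gt_of_ne (Set.mem_compl_singleton_iff.mp hx) with h | h
    · refine (continuousAt_const (y := (1 : ℝ))).congr ?_
      filter_upwards [eventually_lt_nhds h] with y hy
      simp [hy.le]
    · refine (continuousAt_const (y := (0 : ℝ))).congr ?_
      filter_upwards [eventually_gt_nhds h] with y hy
      simp [hy]
  · intro x hx h0
    rw [Set.mem_singleton_iff] at h0
    subst h0
    exact spectrum.zero_notMem_iff ℝ |>.mpr hu hx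

theorem tendsto_matLog {ι : Type*} {l : Filter ι} {a : ι → Matrix n n ℂ}
    {a₀ : Matrix n n ℂ} (ha : Tendsto a l (𝓝 a₀)) (hH : ∀ᶠ t in l, (a t).IsHermitian)
    (h₀ : a₀.PosDef) :
    Tendsto (fun t => matLog (a t)) l (𝓝 (matLog a₀)) := by
  refine tendsto_cfc_of_isOpen (s := {0}ᶜ) isOpen_compl_singleton Real.continuousOn_log ha hH
    h₀.1 ?_
  intro x hx h0
  rw [Set.mem_singleton_iff] at h0
  subst h0
  exact spectrum.zero_notMem_iff ℝ |>.mpr h₀.isUnit hx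

end Continuity

/-! ### Sylvester's law of inertia for the nonpositive projection -/

section Inertia

open Matrix

variable {n : Type*} [Fintype n]

theorem re_star_dotProduct_mulVec (A : Matrix n n ℂ) (v : n → ℂ) :
    (star v ⬝ᵥ A *ᵥ v).re = (vecMulVec v (star v) * A).trace.re := by
  rw [Matrix.trace_mul_comm, Matrix.mul_vecMulVec, Matrix.trace_vecMulVec, dotProduct_comm]

variable [DecidableEq n]

theorem projNonpos_mul_self (X : Matrix n n ℂ) :
    projNonpos X * projNonpos X = projNonpos X := by
  rw [projNonpos, ← cfc_mul _ _ X (continuousOn_spectrum _ _) (continuousOn_spectrum _ _)]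
  congr 1
  ext x
  by_cases hx : x ≤ 0 <;> simp [hx]

theorem trace_projNonpos_eq_rank (X : Matrix n n ℂ) :
    (projNonpos X).trace.re = (projNonpos X).rank := by
  have h : IsIdempotentElem (projNonpos X).toLin' := by
    rw [IsIdempotentElem, Module.End.mul_eq_comp, ← Matrix.toLin'_mul, projNonpos_mul_self]
  have h2 := (LinearMap.IsIdempotentElem.isProj_range _ h).trace
  rw [Matrix.trace_toLin'_eq] at h2
  rw [h2, Complex.natCast_re]
  rfl

/-- With `H = v v*`, the hypothesis gives `Tr H P = Tr H`. This forces the weights of `H` on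
positive eigenvalues of `X` to vanish. -/
theorem re_star_dotProduct_nonpos {X : Matrix n n ℂ} (hX : X.IsHermitian) {v : n → ℂ}
    (hv : projNonpos X *ᵥ v = v) : (star v ⬝ᵥ X *ᵥ v).re ≤ 0 := by
  set H := vecMulVec v (star v) with hH
  have hpos : H.PosSemidef := posSemidef_vecMulVec_self_star v
  have e1 := re_star_dotProduct_mulVec (projNonpos X) v
  have e2 := re_star_dotProduct_mulVec (1 : Matrix n n ℂ) v
  rw [hv, projNonpos, trace_mul_cfc hX] at e1
  rw [Matrix.one_mulVec, Matrix.mul_one, ← sum_specWeight hX, e1, ← sub_eq_zero,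
    ← Finset.sum_sub_distrib, ← neg_eq_zero, ← Finset.sum_neg_distrib,
    Finset.sum_eq_zero_iff_of_nonneg] at e2
  · rw [re_star_dotProduct_mulVec, ← cfc_id_hermitian hX, trace_mul_cfc hX]
    refine Finset.sum_nonpos fun i hi => ?_
    have h3 := e2 i hi
    have h4 := specWeight_nonneg hX hpos i
    by_cases h : hX.eigenvalues i ≤ 0
    · exact mul_nonpos_of_nonneg_of_nonpos h4 h
    · simp only [Set.mem_Iic, h, not_false_eq_true, Set.indicator_of_notMem] at h3
      have : specWeight hX H i = 0 := by linarith
      simp [← hH, this]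
  · intro i _
    have := mul_le_of_le_one_right (specWeight_nonneg hX hpos i)
      (indicator_Iic_le_one (hX.eigenvalues i))
    change 0 ≤ -(_ - _)
    linarith

theorem re_star_dotProduct_pos {X : Matrix n n ℂ} (hX : X.IsHermitian) {v : n → ℂ}
    (hv : projNonpos X *ᵥ v = 0) (hv0 : v ≠ 0) : 0 < (star v ⬝ᵥ X *ᵥ v).re := by
  set H := vecMulVec v (star v) with hH
  have hpos : H.PosSemidef := posSemidef_vecMulVec_self_star v
  have e1 := re_star_dotProduct_mulVec (projNonpos X) v
  rw [hv, projNonpos, trace_mul_cfc hX, dotProduct_zero, Complex.zero_re, eq_comm,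
    Finset.sum_eq_zero_iff_of_nonneg fun i _ => mul_nonneg (specWeight_nonneg hX hpos i)
      (indicator_Iic_nonneg _)] at e1
  have hzero : ∀ i, hX.eigenvalues i ≤ 0 → specWeight hX H i = 0 := fun i hi => by
    simpa [hi] using e1 i (Finset.mem_univ i)
  have hnn : ∀ i, 0 ≤ specWeight hX H i * hX.eigenvalues i := fun i => by
    by_cases h : hX.eigenvalues i ≤ 0
    · simp [hzero i h]
    · exact mul_nonneg (specWeight_nonneg hX hpos i) (not_le.mp h).le
  rw [re_star_dotProduct_mulVec, ← cfc_id_hermitian hX, trace_mul_cfc hX]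
  refine lt_of_le_of_ne (Finset.sum_nonneg fun i _ => hnn i) fun h0 => hv0 ?_
  rw [eq_comm, Finset.sum_eq_zero_iff_of_nonneg fun i _ => hnn i] at h0
  have hall : ∑ i, specWeight hX H i = 0 := Finset.sum_eq_zero fun i _ => by
    by_cases h : hX.eigenvalues i ≤ 0
    · exact hzero i h
    · exact (mul_eq_zero.mp (h0 i (Finset.mem_univ i))).resolve_right (not_le.mp h).ne'
  rw [sum_specWeight, ← Matrix.mul_one H, ← re_star_dotProduct_mulVec, Matrix.one_mulVec] at hall
  have h5 : (star v ⬝ᵥ v).im = 0 :=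
    (Complex.nonneg_iff.mp (dotProduct_star_self_nonneg v)).2.symm
  exact dotProduct_star_self_eq_zero.mp (Complex.ext hall h5)

/-- The map `v ↦ P R⁻¹ v`, with `P` the projection of `Rᴴ * X * R`, is injective on the range of
`projNonpos X`. A nonzero `v` in its kernel would make the form `⟨v, X v⟩` both nonpositive and
positive. -/
theorem rank_projNonpos_le {X R : Matrix n n ℂ} (hX : X.IsHermitian) (hR : IsUnit R.det) :
    (projNonpos X).rank ≤ (projNonpos (Rᴴ * X * R)).rank := by
  have hY : (Rᴴ * X * R).IsHermitian := isHermitian_conjTranspose_mul_mul R hX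
  let f : LinearMap.range (projNonpos X).mulVecLin →ₗ[ℂ]
      LinearMap.range (projNonpos (Rᴴ * X * R)).mulVecLin :=
    ((projNonpos (Rᴴ * X * R)).mulVecLin.rangeRestrict ∘ₗ R⁻¹.mulVecLin) ∘ₗ Submodule.subtype _
  refine LinearMap.finrank_le_finrank_of_injective (f := f) ?_
  rw [← LinearMap.ker_eq_bot, LinearMap.ker_eq_bot']
  rintro ⟨v, u, rfl⟩ hv
  have hv' : projNonpos (Rᴴ * X * R) *ᵥ (R⁻¹ *ᵥ (projNonpos X *ᵥ u)) = 0 :=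
    congrArg Subtype.val hv
  have hfix : projNonpos X *ᵥ (projNonpos X *ᵥ u) = projNonpos X *ᵥ u := by
    rw [Matrix.mulVec_mulVec, projNonpos_mul_self]
  have h1 := re_star_dotProduct_nonpos hX hfix
  ext1
  change projNonpos X *ᵥ u = 0
  set v := projNonpos X *ᵥ u
  by_contra hne
  have hRv : R *ᵥ (R⁻¹ *ᵥ v) = v := by
    rw [Matrix.mulVec_mulVec, Matrix.mul_nonsing_inv R hR, Matrix.one_mulVec]
  have hw : R⁻¹ *ᵥ v ≠ 0 := fun h => hne (by rw [← hRv, h, Matrix.mulVec_zero])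
  have h2 := re_star_dotProduct_pos hY hv' hw
  rw [← Matrix.mulVec_mulVec, hRv, ← Matrix.mulVec_mulVec, Matrix.dotProduct_mulVec,
    ← Matrix.star_mulVec, hRv] at h2
  linarith

/-- Sylvester's law of inertia. -/
theorem trace_projNonpos_congr {X R : Matrix n n ℂ} (hX : X.IsHermitian) (hR : IsUnit R.det) :
    (projNonpos (Rᴴ * X * R)).trace.re = (projNonpos X).trace.re := by
  rw [trace_projNonpos_eq_rank, trace_projNonpos_eq_rank]
  refine congrArg _ (le_antisymm ?_ (rank_projNonpos_le hX hR))
  have h := rank_projNonpos_le (isHermitian_conjTranspose_mul_mul R hX)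
    (R := R⁻¹) (Matrix.isUnit_nonsing_inv_det R hR)
  have e : R⁻¹ᴴ * (Rᴴ * X * R) * R⁻¹ = X := by
    rw [Matrix.mul_assoc, Matrix.mul_assoc (Rᴴ * X), Matrix.mul_nonsing_inv R hR, Matrix.mul_one,
      ← Matrix.mul_assoc, ← Matrix.conjTranspose_mul, Matrix.mul_nonsing_inv R hR,
      Matrix.conjTranspose_one, Matrix.one_mul]
  rwa [e] at h

end Inertia

/-! ### Derivatives along the line `A + x • H` -/

section Path

variable {n : Type*}

theorem isHermitian_smul {A : Matrix n n ℂ} (hA : A.IsHermitian) (t : ℝ) :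
    (t • A).IsHermitian := by
  rw [Matrix.IsHermitian, Matrix.conjTranspose_smul, hA.eq, star_trivial]

theorem isHermitian_sub_smul {A B : Matrix n n ℂ} (hA : A.IsHermitian) (hB : B.IsHermitian)
    (t : ℝ) : (A - t • B).IsHermitian :=
  hA.sub (isHermitian_smul hB t)

theorem isHermitian_add_smul {A B : Matrix n n ℂ} (hA : A.IsHermitian) (hB : B.IsHermitian)
    (t : ℝ) : (A + t • B).IsHermitian :=
  hA.add (isHermitian_smul hB t)

variable [Fintype n]

theorem continuous_reTraceMul (H : Matrix n n ℂ) : Continuous fun X => (H * X).trace.re :=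
  Complex.continuous_re.comp (continuous_const.matrix_mul continuous_id).matrix_trace

variable [DecidableEq n]

/-- The real linear functional `X ↦ Re Tr(H X)`. -/
noncomputable def reTraceMul (H : Matrix n n ℂ) : Matrix n n ℂ →ₗ[ℝ] ℝ :=
  Complex.reLm ∘ₗ ((Matrix.traceLinearMap n ℂ ℂ).restrictScalars ℝ) ∘ₗ (LinearMap.mulLeft ℝ H)

open scoped Matrix.Norms.L2Operator in
theorem norm_projNonpos_le (X : Matrix n n ℂ) : ‖projNonpos X‖ ≤ 1 := by
  refine norm_cfc_le zero_le_one fun x _ => ?_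
  rw [Real.norm_of_nonneg (indicator_Iic_nonneg x)]
  exact indicator_Iic_le_one x

open scoped Matrix.Norms.L2Operator in
theorem exists_abs_trace_mul_projNonpos_le (H : Matrix n n ℂ) :
    ∃ K, ∀ X, |(H * projNonpos X).trace.re| ≤ K := by
  refine ⟨‖(reTraceMul H).toContinuousLinearMap‖, fun X => ?_⟩
  have h := (reTraceMul H).toContinuousLinearMap.le_opNorm (projNonpos X)
  exact h.trans (mul_le_of_le_one_right (norm_nonneg _) (norm_projNonpos_le X))

/-- The exceptional `γ` are the real eigenvalues of `A * B⁻¹`. Off this null set `γ ↦ {A ≤ γB}` is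
continuous. -/
theorem finite_not_isUnit_sub_smul (A : Matrix n n ℂ) {B : Matrix n n ℂ} (hB : B.PosDef) :
    {γ : ℝ | ¬ IsUnit (A - γ • B)}.Finite := by
  refine (Matrix.finite_real_spectrum (A := A * B⁻¹)).subset fun γ hγ => ?_
  rw [spectrum.mem_iff]
  intro hu
  refine hγ ?_
  have h1 : A - γ • B = -((algebraMap ℝ (Matrix n n ℂ) γ - A * B⁻¹) * B) := by
    rw [sub_mul, Matrix.mul_assoc, Matrix.nonsing_inv_mul B
      ((Matrix.isUnit_iff_isUnit_det B).mp hB.isUnit), Matrix.mul_one,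
      Algebra.algebraMap_eq_smul_one, Matrix.smul_mul, Matrix.one_mul, neg_sub]
  rw [h1]
  exact (hu.mul hB.isUnit).neg

theorem continuousAt_projNonpos_sub_smul {A B : Matrix n n ℂ} (hA : A.IsHermitian)
    (hB : B.IsHermitian) {γ : ℝ} (hγ : IsUnit (A - γ • B)) :
    ContinuousAt (fun γ : ℝ => projNonpos (A - γ • B)) γ :=
  tendsto_projNonpos (Continuous.tendsto (by fun_prop) γ)
    (Eventually.of_forall fun t => isHermitian_sub_smul hA hB t) (isHermitian_sub_smul hA hB γ) hγ

theorem aestronglyMeasurable_of_continuousAt_compl {E : Type*} [NormedAddCommGroup E]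
    {f : ℝ → E} {s : Set ℝ} (hs : s.Countable) (hf : ∀ x ∉ s, ContinuousAt f x) :
    AEStronglyMeasurable f volume := by
  have h1 : ContinuousOn f sᶜ := fun x hx => (hf x hx).continuousWithinAt
  have h2 : AEStronglyMeasurable f (volume.restrict sᶜ) :=
    ContinuousOn.aestronglyMeasurable h1 hs.measurableSet.compl
  rwa [Measure.restrict_eq_self_of_ae_mem] at h2
  exact hs.ae_notMem _

theorem aestronglyMeasurable_trace_mul_projNonpos (H : Matrix n n ℂ) {A B : Matrix n n ℂ}
    (hA : A.IsHermitian) (hB : B.PosDef) :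
    AEStronglyMeasurable (fun γ : ℝ => (H * projNonpos (A - γ • B)).trace.re) volume :=
  aestronglyMeasurable_of_continuousAt_compl (finite_not_isUnit_sub_smul A hB).countable
    fun _ hγ => (continuous_reTraceMul H).continuousAt.comp
      (continuousAt_projNonpos_sub_smul hA hB.1 (not_not.mp hγ))

theorem intervalIntegrable_inv_mul {f : ℝ → ℝ} (hf : AEStronglyMeasurable f volume) {K : ℝ}
    {a c : ℝ} (ha : 0 < a) (hac : a ≤ c) (hK : ∀ x ∈ Set.Ioc a c, |f x| ≤ K) :
    IntervalIntegrable (fun γ => γ⁻¹ * f γ) volume a c := by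
  rw [intervalIntegrable_iff_integrableOn_Ioc_of_le hac]
  refine Integrable.mono' (g := fun _ => a⁻¹ * K) (integrable_const _) ?_ ?_
  · exact (measurable_inv.aestronglyMeasurable.mul hf).restrict
  · filter_upwards [ae_restrict_mem measurableSet_Ioc] with x hx
    have hx0 : 0 < x := ha.trans hx.1
    rw [norm_mul, norm_inv, Real.norm_of_nonneg hx0.le, Real.norm_eq_abs]
    exact mul_le_mul (inv_anti₀ ha hx.1.le) (hK x hx) (abs_nonneg _) (inv_nonneg.mpr ha.le)

theorem intervalIntegrable_inv_mul_trace (H : Matrix n n ℂ) {A B : Matrix n n ℂ}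
    (hA : A.IsHermitian) (hB : B.PosDef) {a c : ℝ} (ha : 0 < a) (hac : a ≤ c) :
    IntervalIntegrable (fun γ : ℝ => γ⁻¹ * (H * projNonpos (A - γ • B)).trace.re) volume a c := by
  obtain ⟨K, hK⟩ := exists_abs_trace_mul_projNonpos_le H
  exact intervalIntegrable_inv_mul (aestronglyMeasurable_trace_mul_projNonpos H hA hB) ha hac
    fun x _ => hK _

theorem tendsto_negTrace {ι : Type*} {l : Filter ι} {a : ι → Matrix n n ℂ}
    {a₀ : Matrix n n ℂ} (ha : Tendsto a l (𝓝 a₀)) (hH : ∀ t, (a t).IsHermitian)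
    (h₀ : a₀.IsHermitian) : Tendsto (fun t => negTrace (a t)) l (𝓝 (negTrace a₀)) := by
  have h := tendsto_cfc_of_isOpen (f := fun x => max (-x) 0) isOpen_univ (by fun_prop) ha
    (Eventually.of_forall hH) h₀ (Set.subset_univ _)
  have key : ∀ {X : Matrix n n ℂ}, X.IsHermitian →
      negTrace X = (1 * cfc (fun x : ℝ => max (-x) 0) X).trace.re := fun hX => by
    rw [one_mul, trace_cfc hX, negTrace_eq_sum hX]
  simp only [key h₀, key (hH _)]
  exact ((continuous_reTraceMul 1).tendsto _).comp h

theorem continuous_negTrace_sub_smul {A B : Matrix n n ℂ} (hA : A.IsHermitian)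
    (hB : B.IsHermitian) : Continuous fun γ : ℝ => negTrace (A - γ • B) :=
  continuous_iff_continuousAt.mpr fun γ => tendsto_negTrace
    (Continuous.tendsto (by fun_prop) γ) (fun t => isHermitian_sub_smul hA hB t)
    (isHermitian_sub_smul hA hB γ)

theorem intervalIntegrable_inv_mul_negTrace {A B : Matrix n n ℂ} (hA : A.IsHermitian)
    (hB : B.IsHermitian) {a c : ℝ} (ha : 0 < a) (hc : 0 < c) :
    IntervalIntegrable (fun γ : ℝ => γ⁻¹ * negTrace (A - γ • B)) volume a c := by
  refine ContinuousOn.intervalIntegrable (ContinuousOn.mul ?_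
    (continuous_negTrace_sub_smul hA hB).continuousOn)
  refine continuousOn_inv₀.mono fun x hx => ?_
  exact ((lt_min ha hc).trans_le hx.1).ne'

/-- Integrating the subgradient inequality over `γ` gives a subgradient of the integral. It is
continuous in `x` by dominated convergence, because the projections converge for all but finitely
many `γ`; differentiability follows even though `negTrace` itself is not smooth. -/
theorem hasDerivAt_integral_negTrace {A B H : Matrix n n ℂ} (hA : A.IsHermitian)
    (hB : B.PosDef) (hH : H.IsHermitian) {a c : ℝ} (ha : 0 < a) (hac : a ≤ c) (x₀ : ℝ) :
    HasDerivAt (fun x : ℝ => ∫ γ in a..c, γ⁻¹ * negTrace (A + x • H - γ • B))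
      (-∫ γ in a..c, γ⁻¹ * (H * projNonpos (A + x₀ • H - γ • B)).trace.re) x₀ := by
  have hAx : ∀ x : ℝ, (A + x • H).IsHermitian := isHermitian_add_smul hA hH
  have hX : ∀ x γ : ℝ, (A + x • H - γ • B).IsHermitian := fun x γ =>
    isHermitian_sub_smul (hAx x) hB.1 γ
  have hsub : ∀ x y : ℝ, (∫ γ in a..c, γ⁻¹ * negTrace (A + x • H - γ • B)) +
      (y - x) * (-∫ γ in a..c, γ⁻¹ * (H * projNonpos (A + x • H - γ • B)).trace.re) ≤
      ∫ γ in a..c, γ⁻¹ * negTrace (A + y • H - γ • B) := by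
    intro x y
    have i1 := intervalIntegrable_inv_mul_negTrace (hAx x) hB.1 ha (ha.trans_le hac)
    have i2 := intervalIntegrable_inv_mul_trace H (hAx x) hB ha hac
    have i3 := intervalIntegrable_inv_mul_negTrace (hAx y) hB.1 ha (ha.trans_le hac)
    rw [mul_neg, ← sub_eq_add_neg, ← intervalIntegral.integral_const_mul,
      ← intervalIntegral.integral_sub i1 (i2.const_mul _)]
    refine intervalIntegral.integral_mono_on hac (i1.sub (i2.const_mul _)) i3 fun γ hγ => ?_
    have h := negTrace_add_le (hX x γ) (hX y γ)
    have e : A + y • H - γ • B - (A + x • H - γ • B) = (y - x) • H := by module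
    rw [e, Matrix.smul_mul, Matrix.trace_smul, Complex.real_smul, Complex.re_ofReal_mul] at h
    have := mul_le_mul_of_nonneg_left h (inv_nonneg.mpr (ha.le.trans hγ.1))
    linarith
  refine hasDerivAt_of_subgradient
    (q := fun x => -∫ γ in a..c, γ⁻¹ * (H * projNonpos (A + x • H - γ • B)).trace.re)
    (Eventually.of_forall fun y => hsub x₀ y) (Eventually.of_forall fun y => hsub y x₀) ?_
  refine ContinuousAt.neg ?_
  obtain ⟨K, hK⟩ := exists_abs_trace_mul_projNonpos_le H
  refine intervalIntegral.tendsto_integral_filter_of_dominated_convergence (fun _ => a⁻¹ * K)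
    (Eventually.of_forall fun x => ?_) (Eventually.of_forall fun x => ?_) (by simp) ?_
  · exact (measurable_inv.aestronglyMeasurable.mul
      (aestronglyMeasurable_trace_mul_projNonpos H (hAx x) hB)).restrict
  · refine Eventually.of_forall fun γ hγ => ?_
    rw [Set.uIoc_of_le hac] at hγ
    have hx0 : 0 < γ := ha.trans hγ.1
    rw [norm_mul, norm_inv, Real.norm_of_nonneg hx0.le, Real.norm_eq_abs]
    exact mul_le_mul (inv_anti₀ ha hγ.1.le) (hK _) (abs_nonneg _) (inv_nonneg.mpr ha.le)
  · filter_upwards [(finite_not_isUnit_sub_smul (A + x₀ • H) hB).countable.ae_notMem volume]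
      with γ hγ _
    refine Tendsto.const_mul _ (((continuous_reTraceMul H).tendsto _).comp ?_)
    exact tendsto_projNonpos (Continuous.tendsto (by fun_prop) x₀)
      (Eventually.of_forall fun x => hX x γ) (hX x₀ γ) (not_not.mp hγ)

open scoped Matrix.Norms.L2Operator in
theorem eventually_posDef {ι : Type*} {l : Filter ι} {a : ι → Matrix n n ℂ}
    {a₀ : Matrix n n ℂ} (ha : Tendsto a l (𝓝 a₀)) (hH : ∀ t, (a t).IsHermitian)
    (h₀ : a₀.PosDef) : ∀ᶠ t in l, (a t).PosDef := by
  have hS : Set.Ioi (0 : ℝ) ∈ 𝓝ˢ (spectrum ℝ a₀) := by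
    refine isOpen_Ioi.mem_nhdsSet.mpr fun x hx => ?_
    rw [h₀.1.spectrum_real_eq_range_eigenvalues] at hx
    obtain ⟨i, rfl⟩ := hx
    exact h₀.eigenvalues_pos i
  have hev : ∀ᶠ x' in 𝓝 a₀, spectrum ℝ x' ⊆ Set.Ioi 0 :=
    ((upperHemicontinuous_spectrum ℝ (Matrix n n ℂ)).upperHemicontinuousAt a₀ _ hS).mono
      fun _ => subset_of_mem_nhdsSet
  filter_upwards [ha.eventually hev] with t ht
  exact (hH t).posDef_iff_eigenvalues_pos.mpr fun i =>
    ht ((hH t).eigenvalues_mem_spectrum_real i)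

/-- Klein's inequality says that `log X + 1` is a subgradient of `X ↦ Tr X log X`, and it depends
continuously on `X`. -/
theorem hasDerivAt_trace_mul_log {A H : Matrix n n ℂ} (hA : A.IsHermitian) (hH : H.IsHermitian)
    {x₀ : ℝ} (h₀ : (A + x₀ • H).PosDef) :
    HasDerivAt (fun x : ℝ => ((A + x • H) * matLog (A + x • H)).trace.re)
      (H * (matLog (A + x₀ • H) + 1)).trace.re x₀ := by
  have hAx : ∀ x : ℝ, (A + x • H).IsHermitian := isHermitian_add_smul hA hH
  have hcont : Tendsto (fun x : ℝ => A + x • H) (𝓝 x₀) (𝓝 (A + x₀ • H)) :=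
    Continuous.tendsto (by fun_prop) x₀
  have hev := eventually_posDef hcont hAx h₀
  have hsub : ∀ {x y : ℝ}, (A + x • H).PosDef → (A + y • H).PosDef →
      ((A + x • H) * matLog (A + x • H)).trace.re +
      (y - x) * (H * (matLog (A + x • H) + 1)).trace.re ≤
      ((A + y • H) * matLog (A + y • H)).trace.re := by
    intro x y hx hy
    have h := trace_mul_log_klein hx hy
    have e : A + y • H - (A + x • H) = (y - x) • H := by module
    rwa [e, Matrix.smul_mul, Matrix.trace_smul, Complex.real_smul, Complex.re_ofReal_mul] at h
  refine hasDerivAt_of_subgradient (q := fun x => (H * (matLog (A + x • H) + 1)).trace.re)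
    (hev.mono fun y hy => hsub h₀ hy) (hev.mono fun y hy => hsub hy h₀) ?_
  exact ((continuous_reTraceMul H).tendsto _).comp
    ((tendsto_matLog hcont (Eventually.of_forall hAx) h₀).add_const 1)

end Path

/-! ### Frenkel's integral formula for positive definite matrices -/

section Frenkel

variable {n : Type*}

theorem posSemidef_sub_smul_of_le {A B : Matrix n n ℂ} (hB : B.PosSemidef) {a a' : ℝ}
    (haB : (A - a • B).PosSemidef) (h : a' ≤ a) : (A - a' • B).PosSemidef := by
  have : A - a' • B = (A - a • B) + (a - a') • B := by module
  rw [this]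
  exact haB.add (hB.smul (sub_nonneg.mpr h))

theorem posSemidef_smul_sub_of_le {A B : Matrix n n ℂ} (hB : B.PosSemidef) {c c' : ℝ}
    (hcB : (c • B - A).PosSemidef) (h : c ≤ c') : (c' • B - A).PosSemidef := by
  have : c' • B - A = (c • B - A) + (c' - c) • B := by module
  rw [this]
  exact hcB.add (hB.smul (sub_nonneg.mpr h))

variable [Fintype n] [DecidableEq n]

theorem cfc_cfc (f g : ℝ → ℝ) {X : Matrix n n ℂ} (hX : X.IsHermitian) :
    cfc f (cfc g X) = cfc (fun x => f (g x)) X :=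
  (cfc_comp' f g X ((Set.Finite.image _ (Matrix.finite_real_spectrum (A := X))).continuousOn _)
    (continuousOn_spectrum _ _) hX.isSelfAdjoint).symm

theorem sub_smul_one_eq_cfc {X : Matrix n n ℂ} (hX : X.IsHermitian) (t : ℝ) :
    X - t • (1 : Matrix n n ℂ) = cfc (fun x => x - t) X := by
  rw [cfc_sub (fun x => x) (fun _ => t) X (continuousOn_spectrum _ _) (continuousOn_spectrum _ _),
    cfc_id_hermitian hX, cfc_const t X hX.isSelfAdjoint, Algebra.algebraMap_eq_smul_one]

theorem one_sub_smul_eq_cfc {X : Matrix n n ℂ} (hX : X.IsHermitian) (t : ℝ) :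
    (1 : Matrix n n ℂ) - t • X = cfc (fun x => 1 - t * x) X := by
  rw [cfc_sub (fun _ => 1) (fun x => t * x) X (continuousOn_spectrum _ _)
    (continuousOn_spectrum _ _), cfc_one_hermitian hX,
    cfc_const_mul t (fun x => x) X (continuousOn_spectrum _ _), cfc_id_hermitian hX]

theorem eigenvalues_eq_re {X : Matrix n n ℂ} (hX : X.IsHermitian) (i : n) :
    (star (hX.eigenvectorBasis i : n → ℂ) ⬝ᵥ (X.mulVec (hX.eigenvectorBasis i))).re
      = hX.eigenvalues i := (hX.eigenvalues_eq i).symm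

theorem star_dotProduct_eigenvectorBasis {X : Matrix n n ℂ} (hX : X.IsHermitian) (i : n) :
    (star (hX.eigenvectorBasis i : n → ℂ) ⬝ᵥ (hX.eigenvectorBasis i : n → ℂ)).re = 1 := by
  have h := hX.eigenvectorBasis.orthonormal.1 i
  have h3 := inner_self_eq_norm_sq (𝕜 := ℂ) (hX.eigenvectorBasis i)
  rw [h, EuclideanSpace.inner_eq_star_dotProduct, dotProduct_comm] at h3
  simpa using h3

theorem le_eigenvalues {X : Matrix n n ℂ} (hX : X.IsHermitian) {t : ℝ}
    (h : (X - t • (1 : Matrix n n ℂ)).PosSemidef) (i : n) : t ≤ hX.eigenvalues i := by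
  have h1 := h.re_dotProduct_nonneg (hX.eigenvectorBasis i)
  rw [Matrix.sub_mulVec, dotProduct_sub, map_sub, Matrix.smul_mulVec, Matrix.one_mulVec,
    dotProduct_smul] at h1
  have h2 := eigenvalues_eq_re hX i
  have h3 := star_dotProduct_eigenvectorBasis hX i
  simp only [RCLike.re_to_complex, Complex.real_smul, Complex.re_ofReal_mul, h2, h3] at h1
  linarith

theorem eigenvalues_le {X : Matrix n n ℂ} (hX : X.IsHermitian) {t : ℝ}
    (h : (t • (1 : Matrix n n ℂ) - X).PosSemidef) (i : n) : hX.eigenvalues i ≤ t := by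
  have h1 := h.re_dotProduct_nonneg (hX.eigenvectorBasis i)
  rw [Matrix.sub_mulVec, dotProduct_sub, map_sub, Matrix.smul_mulVec, Matrix.one_mulVec,
    dotProduct_smul] at h1
  have h2 := eigenvalues_eq_re hX i
  have h3 := star_dotProduct_eigenvectorBasis hX i
  simp only [RCLike.re_to_complex, Complex.real_smul, Complex.re_ofReal_mul, h2, h3] at h1
  linarith

theorem inv_mul_indicator_intervalIntegrable {a c : ℝ} (ha : 0 < a) (hac : a ≤ c) (κ : ℝ) :
    IntervalIntegrable (fun γ : ℝ => γ⁻¹ * (Set.Ici κ).indicator (fun _ => (1 : ℝ)) γ)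
      volume a c := by
  refine intervalIntegrable_inv_mul (K := 1)
    (measurable_const.indicator measurableSet_Ici).aestronglyMeasurable ha hac fun x _ => ?_
  rw [abs_of_nonneg (Set.indicator_nonneg (fun _ _ => zero_le_one) _)]
  exact Set.indicator_le_self' (fun _ _ => zero_le_one) _

theorem integral_inv_mul_indicator {a c κ : ℝ} (ha : 0 < a) (haκ : a ≤ κ) (hκc : κ ≤ c) :
    ∫ γ in a..c, γ⁻¹ * (Set.Ici κ).indicator (fun _ => (1 : ℝ)) γ
      = Real.log c - Real.log κ := by
  have hκ : 0 < κ := ha.trans_le haκ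
  have hc : 0 < c := hκ.trans_le hκc
  have h1 : (fun γ : ℝ => γ⁻¹ * (Set.Ici κ).indicator (fun _ => (1 : ℝ)) γ)
      = (Set.Ici κ).indicator (fun γ => γ⁻¹) := by
    ext γ
    by_cases h : γ ∈ Set.Ici κ <;> simp [h]
  have h2 : (Set.Ioc a c ∩ Set.Ici κ : Set ℝ) =ᵐ[volume] Set.Ioc κ c := by
    have h3 : (Set.Ioc a c ∩ Set.Ici κ : Set ℝ) =ᵐ[volume] (Set.Ioc a c ∩ Set.Ioi κ : Set ℝ) :=
      (ae_eq_refl _).inter Ioi_ae_eq_Ici.symm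
    rwa [Set.Ioc_inter_Ioi, max_eq_right haκ] at h3
  rw [h1, intervalIntegral.integral_of_le (haκ.trans hκc), setIntegral_indicator measurableSet_Ici,
    setIntegral_congr_set h2, ← intervalIntegral.integral_of_le hκc, integral_inv_of_pos hκ hc,
    Real.log_div hc.ne' hκ.ne']

theorem exists_conjTranspose_mul_mul_eq_one {B : Matrix n n ℂ} (hB : B.PosDef) :
    ∃ R : Matrix n n ℂ, R.conjTranspose * B * R = 1 ∧ IsUnit R.det := by
  set R : Matrix n n ℂ := cfc (fun x : ℝ => (Real.sqrt x)⁻¹) B with hR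
  have hRH : R.IsHermitian := cfc_predicate (R := ℝ) (p := IsSelfAdjoint) _ B
  have h1 : R.conjTranspose * B * R = 1 := by
    rw [hRH.eq, hR]
    nth_rewrite 2 [← cfc_id_hermitian hB.1]
    rw [← cfc_mul _ _ B (continuousOn_spectrum _ _) (continuousOn_spectrum _ _),
      ← cfc_mul _ _ B (continuousOn_spectrum _ _) (continuousOn_spectrum _ _),
      ← cfc_one_hermitian hB.1]
    refine cfc_congr fun x hx => ?_
    rw [hB.1.spectrum_real_eq_range_eigenvalues] at hx
    obtain ⟨i, rfl⟩ := hx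
    have hpos := hB.eigenvalues_pos i
    have hs := Real.mul_self_sqrt hpos.le
    have hs0 := (Real.sqrt_pos.mpr hpos).ne'
    field_simp
    rw [sq, hs]
  refine ⟨R, h1, ?_⟩
  exact Matrix.isUnit_det_of_left_inverse h1

theorem trace_matLog {A : Matrix n n ℂ} (hA : A.PosDef) :
    (matLog A).trace.re = Real.log A.det.re := by
  have h : A.det.re = ∏ i, hA.1.eigenvalues i := by
    rw [hA.1.det_eq_prod_eigenvalues]
    simp only [RCLike.ofReal_eq_complex_ofReal]
    rw [← Complex.ofReal_prod, Complex.ofReal_re]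
  rw [matLog, trace_cfc hA.1, h, Real.log_prod fun i _ => (hA.eigenvalues_pos i).ne']

/-- Congruence by `R`, with `Rᴴ B R = 1`, turns the trace into the number of eigenvalues of `K = Rᴴ
A R` not exceeding `γ`. An eigenvalue `κ` contributes `log c - log κ`, and the sum of `log κ` is
`log det A - log det B`. -/
theorem integral_trace_projNonpos {A B : Matrix n n ℂ} (hA : A.PosDef) (hB : B.PosDef) {a c : ℝ}
    (ha : 0 < a) (hac : a ≤ c) (haB : (A - a • B).PosSemidef) (hcB : (c • B - A).PosSemidef) :
    ∫ γ in a..c, γ⁻¹ * (projNonpos (A - γ • B)).trace.re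
      = Fintype.card n * Real.log c + (matLog B).trace.re - (matLog A).trace.re := by
  obtain ⟨R, hR, hRu⟩ := exists_conjTranspose_mul_mul_eq_one hB
  set K := R.conjTranspose * A * R with hK
  have hRinj : Function.Injective R.mulVec :=
    Matrix.mulVec_injective_of_isUnit ((Matrix.isUnit_iff_isUnit_det R).mpr hRu)
  have hKp : K.PosDef := hA.conjTranspose_mul_mul_same hRinj
  have hconj : ∀ γ : ℝ, R.conjTranspose * (A - γ • B) * R = K - γ • (1 : Matrix n n ℂ) := by
    intro γ
    rw [mul_sub, sub_mul, ← hK, Matrix.mul_smul, Matrix.smul_mul, hR]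
  have hlo : ∀ i, a ≤ hKp.1.eigenvalues i := le_eigenvalues hKp.1 <| by
    rw [← hconj]; exact haB.conjTranspose_mul_mul_same R
  have hhi : ∀ i, hKp.1.eigenvalues i ≤ c := eigenvalues_le hKp.1 <| by
    have := hcB.conjTranspose_mul_mul_same R
    rwa [← neg_sub, mul_neg, neg_mul, hconj, neg_sub] at this
  have htr : ∀ γ : ℝ, (projNonpos (A - γ • B)).trace.re
      = ∑ i, (Set.Ici (hKp.1.eigenvalues i)).indicator (fun _ => (1 : ℝ)) γ := by
    intro γ
    rw [← trace_projNonpos_congr (isHermitian_sub_smul hA.1 hB.1 γ) hRu, hconj,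
      sub_smul_one_eq_cfc hKp.1, projNonpos, cfc_cfc _ _ hKp.1, trace_cfc hKp.1]
    refine Finset.sum_congr rfl fun i _ => ?_
    by_cases h : hKp.1.eigenvalues i ≤ γ <;> simp [h]
  simp only [htr, Finset.mul_sum]
  rw [intervalIntegral.integral_finsetSum fun i _ =>
    inv_mul_indicator_intervalIntegrable ha hac _]
  simp only [integral_inv_mul_indicator ha (hlo _) (hhi _)]
  rw [Finset.sum_sub_distrib, Finset.sum_const, Finset.card_univ, nsmul_eq_mul,
    ← trace_cfc hKp.1 Real.log]
  have h1 : (matLog K).trace.re = (matLog A).trace.re - (matLog B).trace.re := by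
    rw [trace_matLog hKp, trace_matLog hA, trace_matLog hB]
    have d1 : K.det * B.det = A.det := by
      have := congrArg Matrix.det hR
      rw [Matrix.det_mul, Matrix.det_mul, Matrix.det_one] at this
      rw [hK, Matrix.det_mul, Matrix.det_mul]
      linear_combination A.det * this
    have kp := Complex.pos_iff.mp hKp.det_pos
    have bp := Complex.pos_iff.mp hB.det_pos
    have d2 : A.det.re = K.det.re * B.det.re := by
      rw [← d1, Complex.mul_re, ← kp.2, ← bp.2]; ring
    rw [d2, Real.log_mul kp.1.ne' bp.1.ne']
    ring
  rw [matLog] at h1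
  rw [h1]
  ring

/-- Here the projection is itself a function of `B`, so the integral can be computed in an
eigenbasis of `B` for arbitrary `H`: an eigenvalue `b` is selected once `γ ≥ b⁻¹`. -/
theorem integral_trace_mul_projNonpos_one_sub {B : Matrix n n ℂ} (H : Matrix n n ℂ)
    (hB : B.PosDef) {a c : ℝ} (ha : 0 < a) (hac : a ≤ c) (haB : (1 - a • B).PosSemidef)
    (hcB : (c • B - 1).PosSemidef) :
    ∫ γ in a..c, γ⁻¹ * (H * projNonpos (1 - γ • B)).trace.re
      = Real.log c * H.trace.re + (H * matLog B).trace.re := by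
  have hc : 0 < c := ha.trans_le hac
  have hlo : ∀ i, c⁻¹ ≤ hB.1.eigenvalues i := le_eigenvalues hB.1 <| by
    have : B - c⁻¹ • (1 : Matrix n n ℂ) = c⁻¹ • (c • B - 1) := by
      rw [smul_sub, smul_smul, inv_mul_cancel₀ hc.ne', one_smul]
    rw [this]
    exact hcB.smul (inv_nonneg.mpr hc.le)
  have hhi : ∀ i, hB.1.eigenvalues i ≤ a⁻¹ := eigenvalues_le hB.1 <| by
    have : a⁻¹ • (1 : Matrix n n ℂ) - B = a⁻¹ • (1 - a • B) := by
      rw [smul_sub, smul_smul, inv_mul_cancel₀ ha.ne', one_smul]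
    rw [this]
    exact haB.smul (inv_nonneg.mpr ha.le)
  have hpos := hB.eigenvalues_pos
  have htr : ∀ γ : ℝ, γ⁻¹ * (H * projNonpos (1 - γ • B)).trace.re
      = ∑ i, specWeight hB.1 H i *
        (γ⁻¹ * (Set.Ici (hB.1.eigenvalues i)⁻¹).indicator (fun _ => (1 : ℝ)) γ) := by
    intro γ
    rw [one_sub_smul_eq_cfc hB.1, projNonpos, cfc_cfc _ _ hB.1, trace_mul_cfc hB.1, Finset.mul_sum]
    refine Finset.sum_congr rfl fun i _ => ?_
    have : (hB.1.eigenvalues i)⁻¹ ≤ γ ↔ 1 ≤ γ * hB.1.eigenvalues i :=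
      inv_le_iff_one_le_mul₀ (hpos i)
    by_cases h : 1 ≤ γ * hB.1.eigenvalues i
    · simp [h, this]; ring
    · simp [h, this]
  simp only [htr]
  rw [intervalIntegral.integral_finsetSum fun i _ =>
    (inv_mul_indicator_intervalIntegrable ha hac _).const_mul _]
  simp only [intervalIntegral.integral_const_mul]
  have h2 : ∀ i, ∫ γ in a..c, γ⁻¹ *
      (Set.Ici (hB.1.eigenvalues i)⁻¹).indicator (fun _ => (1 : ℝ)) γ
      = Real.log c + Real.log (hB.1.eigenvalues i) := fun i => by
    rw [integral_inv_mul_indicator ha, Real.log_inv, sub_neg_eq_add]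
    · exact (le_inv_comm₀ ha (hpos i)).mpr (hhi i)
    · exact (inv_le_comm₀ hc (hpos i)).mp (hlo i)
  simp only [h2, mul_add]
  rw [Finset.sum_add_distrib, ← Finset.sum_mul, sum_specWeight, matLog, trace_mul_cfc hB.1]
  ring

/-- The two sides of Frenkel's integral formula for the relative entropy of positive definite
matrices with `a B ≤ A ≤ c B`, subtracted from each other. -/
noncomputable def frenkelGap (B : Matrix n n ℂ) (a c : ℝ) (A : Matrix n n ℂ) : ℝ :=
  (∫ γ in a..c, γ⁻¹ * negTrace (A - γ • B)) -
    ((A * matLog A).trace.re - (A * matLog B).trace.re - Real.log c * A.trace.re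
      + c * B.trace.re - A.trace.re)

theorem hasDerivAt_frenkelGap {A B H : Matrix n n ℂ} (hA : A.IsHermitian)
    (hB : B.PosDef) (hH : H.IsHermitian) {a c : ℝ} (ha : 0 < a) (hac : a ≤ c) {x₀ : ℝ}
    (h₀ : (A + x₀ • H).PosDef) :
    HasDerivAt (fun x : ℝ => frenkelGap B a c (A + x • H))
      (Real.log c * H.trace.re + (H * matLog B).trace.re - (H * matLog (A + x₀ • H)).trace.re
        - ∫ γ in a..c, γ⁻¹ * (H * projNonpos (A + x₀ • H - γ • B)).trace.re) x₀ := by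
  have d1 := hasDerivAt_integral_negTrace hA hB hH ha hac x₀
  have d2 := hasDerivAt_trace_mul_log hA hH h₀
  have d3 : HasDerivAt (fun x : ℝ => ((A + x • H) * matLog B).trace.re)
      (H * matLog B).trace.re x₀ := by
    have : (fun x : ℝ => ((A + x • H) * matLog B).trace.re) =
        fun x => (A * matLog B).trace.re + x * (H * matLog B).trace.re := by
      ext x; simp [add_mul]
    rw [this]
    simpa using ((hasDerivAt_id x₀).mul_const (H * matLog B).trace.re).const_add
      ((A * matLog B).trace.re)
  have d4 : HasDerivAt (fun x : ℝ => (A + x • H).trace.re) H.trace.re x₀ := by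
    have : (fun x : ℝ => (A + x • H).trace.re) = fun x => A.trace.re + x * H.trace.re := by
      ext x; simp
    rw [this]
    simpa using ((hasDerivAt_id x₀).mul_const H.trace.re).const_add A.trace.re
  have h := d1.sub ((((d2.sub d3).sub (d4.const_mul (Real.log c))).add_const
    (c * B.trace.re)).sub d4)
  refine h.congr_deriv ?_
  rw [mul_add, mul_one, Matrix.trace_add, Complex.add_re]
  ring

/-- Along `A + x • 1` the derivative of the gap vanishes by `integral_trace_projNonpos`; the bounds
by multiples of `B` hold for every `x` in `[0, 1]`. -/
theorem frenkelGap_add_one {A B : Matrix n n ℂ} (hA : A.PosDef) (hB : B.PosDef) {a c : ℝ}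
    (ha : 0 < a) (hac : a ≤ c) (haB : (A - a • B).PosSemidef) (hcB : (c • B - (A + 1)).PosSemidef) :
    frenkelGap B a c (A + 1) = frenkelGap B a c A := by
  have hp : ∀ x : ℝ, 0 ≤ x → (A + x • (1 : Matrix n n ℂ)).PosDef := fun x hx =>
    hA.add_posSemidef (Matrix.PosSemidef.one.smul hx)
  have hd : ∀ x ∈ Set.Icc (0 : ℝ) 1,
      HasDerivAt (fun x : ℝ => frenkelGap B a c (A + x • (1 : Matrix n n ℂ))) 0 x := by
    intro x hx
    have h := hasDerivAt_frenkelGap hA.1 hB Matrix.isHermitian_one ha hac (hp x hx.1)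
    refine h.congr_deriv ?_
    simp only [one_mul]
    rw [integral_trace_projNonpos (hp x hx.1) hB ha hac]
    · simp; ring
    · have : A + x • (1 : Matrix n n ℂ) - a • B = (A - a • B) + x • (1 : Matrix n n ℂ) := by abel
      rw [this]
      exact haB.add (Matrix.PosSemidef.one.smul hx.1)
    · have : c • B - (A + x • (1 : Matrix n n ℂ))
          = (c • B - (A + 1)) + (1 - x) • (1 : Matrix n n ℂ) := by module
      rw [this]
      exact hcB.add (Matrix.PosSemidef.one.smul (sub_nonneg.mpr hx.2))
  have h := constant_of_has_deriv_right_zero (fun x hx => (hd x hx).continuousAt.continuousWithinAt)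
    (fun x hx => (hd x ⟨hx.1, hx.2.le⟩).hasDerivWithinAt) 1 ⟨zero_le_one, le_rfl⟩
  simpa using h

theorem negTrace_sub_smul_of_le {A B : Matrix n n ℂ} {γ : ℝ} (h : (γ • B - A).PosSemidef) :
    negTrace (A - γ • B) = γ * B.trace.re - A.trace.re := by
  rw [negTrace, projNonpos_of_neg (by rwa [neg_sub]), mul_one]
  simp

/-- Below `a` the matrix `A - γB` is positive semidefinite, so the integrand is zero. -/
theorem frenkelGap_lower {A B : Matrix n n ℂ} (hA : A.IsHermitian) (hB : B.PosSemidef)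
    {a a' c : ℝ} (ha' : 0 < a') (haa : a' ≤ a) (hac : a ≤ c) (haB : (A - a • B).PosSemidef) :
    frenkelGap B a' c A = frenkelGap B a c A := by
  have ha := ha'.trans_le haa
  have hc := ha.trans_le hac
  rw [frenkelGap, frenkelGap, ← intervalIntegral.integral_add_adjacent_intervals
    (intervalIntegrable_inv_mul_negTrace hA hB.1 ha' ha)
    (intervalIntegrable_inv_mul_negTrace hA hB.1 ha hc)]
  have : ∫ γ in a'..a, γ⁻¹ * negTrace (A - γ • B) = ∫ γ in a'..a, (0 : ℝ) := by
    refine intervalIntegral.integral_congr fun γ hγ => ?_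
    rw [Set.uIcc_of_le haa] at hγ
    rw [negTrace_of_posSemidef (posSemidef_sub_smul_of_le hB haB hγ.2), mul_zero]
  rw [this]
  simp

/-- Above `c` the integrand is `Tr B - γ⁻¹ Tr A`, whose integral matches the change in the terms `c
Tr B - log c · Tr A`. -/
theorem frenkelGap_upper {A B : Matrix n n ℂ} (hA : A.IsHermitian) (hB : B.PosSemidef)
    {a c c' : ℝ} (ha : 0 < a) (hac : a ≤ c) (hcc : c ≤ c') (hcB : (c • B - A).PosSemidef) :
    frenkelGap B a c' A = frenkelGap B a c A := by
  have hc := ha.trans_le hac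
  have hc' := hc.trans_le hcc
  rw [frenkelGap, frenkelGap, ← intervalIntegral.integral_add_adjacent_intervals
    (intervalIntegrable_inv_mul_negTrace hA hB.1 ha hc)
    (intervalIntegrable_inv_mul_negTrace hA hB.1 hc hc')]
  have h0 : (0 : ℝ) ∉ Set.uIcc c c' := by
    rw [Set.uIcc_of_le hcc]; exact fun h => absurd h.1 (not_le.mpr hc)
  have : ∫ γ in c..c', γ⁻¹ * negTrace (A - γ • B)
      = ∫ γ in c..c', (B.trace.re - A.trace.re * γ⁻¹) := by
    refine intervalIntegral.integral_congr fun γ hγ => ?_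
    rw [Set.uIcc_of_le hcc] at hγ
    have hγ0 : γ ≠ 0 := (hc.trans_le hγ.1).ne'
    rw [negTrace_sub_smul_of_le (posSemidef_smul_sub_of_le hB hcB hγ.1)]
    field_simp
  rw [this, intervalIntegral.integral_sub (by simp)
    ((intervalIntegral.intervalIntegrable_inv (fun x hx h => h0 (h ▸ hx)) continuousOn_id).const_mul
      _),
    intervalIntegral.integral_const_mul, integral_inv_of_pos hc hc', Real.log_div hc'.ne' hc.ne']
  simp
  ring

theorem mul_log_smul {A : Matrix n n ℂ} (hA : A.PosDef) {t : ℝ} (ht : 0 < t) :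
    (t • A * matLog (t • A)).trace.re
      = t * (A * matLog A).trace.re + t * Real.log t * A.trace.re := by
  have h1 : matLog (t • A) = Real.log t • (1 : Matrix n n ℂ) + matLog A := by
    rw [matLog, matLog, ← cfc_comp_smul t Real.log A
      ((Set.Finite.image _ (Matrix.finite_real_spectrum (A := A))).continuousOn _)
      hA.1.isSelfAdjoint, ← Algebra.algebraMap_eq_smul_one,
      ← cfc_const (Real.log t) A hA.1.isSelfAdjoint,
      ← cfc_add _ _ _ (continuousOn_spectrum _ _) (continuousOn_spectrum _ _)]
    refine cfc_congr fun x hx => ?_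
    rw [hA.1.spectrum_real_eq_range_eigenvalues] at hx
    obtain ⟨i, rfl⟩ := hx
    exact Real.log_mul ht.ne' (hA.eigenvalues_pos i).ne'
  rw [h1, mul_add, Matrix.mul_smul, Matrix.mul_one]
  simp
  ring

theorem frenkelGap_smul {A B : Matrix n n ℂ} (hA : A.PosDef) (hB : B.IsHermitian) {a c t : ℝ}
    (hc : 0 < c) (ht : 0 < t) :
    frenkelGap B (t * a) (t * c) (t • A) = t * frenkelGap B a c A := by
  have h1 : ∫ γ in (t * a)..(t * c), γ⁻¹ * negTrace (t • A - γ • B)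
      = t * ∫ γ in a..c, γ⁻¹ * negTrace (A - γ • B) := by
    rw [← intervalIntegral.smul_integral_comp_mul_left, smul_eq_mul]
    congr 1
    refine intervalIntegral.integral_congr fun γ _ => ?_
    have : t • A - (t * γ) • B = t • (A - γ • B) := by module
    rw [this, negTrace_smul (isHermitian_sub_smul hA.1 hB γ) ht]
    field_simp
  rw [frenkelGap, frenkelGap, h1, mul_log_smul hA ht, Real.log_mul ht.ne' hc.ne']
  simp
  ring

theorem exists_posSemidef_sub_smul {A B : Matrix n n ℂ} (hA : A.PosDef) (hB : B.IsHermitian) :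
    ∃ a : ℝ, 0 < a ∧ (A - a • B).PosSemidef := by
  have hev : ∀ᶠ a : ℝ in 𝓝 0, (A - a • B).PosDef :=
    eventually_posDef (a₀ := A) (Continuous.tendsto' (by fun_prop) 0 A (by simp))
      (fun t => isHermitian_sub_smul hA.1 hB t) hA
  obtain ⟨a, ha, ha0⟩ := ((hev.filter_mono nhdsWithin_le_nhds).and
    (self_mem_nhdsWithin : Set.Ioi (0 : ℝ) ∈ 𝓝[>] 0)).exists
  exact ⟨a, ha0, ha.posSemidef⟩

theorem exists_posSemidef_smul_sub {A B : Matrix n n ℂ} (hA : A.IsHermitian) (hB : B.PosDef) :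
    ∃ c : ℝ, 0 < c ∧ (c • B - A).PosSemidef := by
  obtain ⟨a, ha, h⟩ := exists_posSemidef_sub_smul hB hA
  refine ⟨a⁻¹, inv_pos.mpr ha, ?_⟩
  have : a⁻¹ • B - A = a⁻¹ • (B - a • A) := by
    rw [smul_sub, smul_smul, inv_mul_cancel₀ ha.ne', one_smul]
  rw [this]
  exact h.smul (inv_nonneg.mpr ha.le)

/-- Translation invariance and homogeneity make the gap linear in `ε` along `1 + ε • A`, with slope
the gap at `A`. The derivative there at `ε = 0` is known to be zero since the base point commutes
with `B`. -/
theorem frenkelGap_eq_zero_of_bounds {A B : Matrix n n ℂ} (hA : A.PosDef) (hB : B.PosDef)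
    {a c : ℝ} (ha : 0 < a) (hac : a ≤ c) (haA : (A - a • B).PosSemidef)
    (ha1 : (1 - a • B).PosSemidef) (hc : (c • B - (A + 1)).PosSemidef) :
    frenkelGap B a c A = 0 := by
  have hc0 := ha.trans_le hac
  have hcA : (c • B - A).PosSemidef := by
    have : c • B - A = (c • B - (A + 1)) + 1 := by abel
    rw [this]; exact hc.add Matrix.PosSemidef.one
  have hc1 : (c • B - 1).PosSemidef := by
    have : c • B - 1 = (c • B - (A + 1)) + A := by abel
    rw [this]; exact hc.add hA.posSemidef
  -- The interval is adjusted for free: `a` is lowered to `ε * a`, and for the unscaled `A` the end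
  -- `c` is raised to `c / ε`, so that scaling by `ε` yields exactly `[ε * a, c]`.
  have key : ∀ ε ∈ Set.Ioc (0 : ℝ) 1, frenkelGap B a c (1 + ε • A) = ε * frenkelGap B a c A := by
    intro ε hε
    have hεA : (ε • A).PosDef := hA.smul hε.1
    have hεa : ε * a ≤ a := mul_le_of_le_one_left ha.le hε.2
    have hεa0 : 0 < ε * a := mul_pos hε.1 ha
    have e1 : (ε • A - (ε * a) • B).PosSemidef := by
      have : ε • A - (ε * a) • B = ε • (A - a • B) := by module
      rw [this]; exact haA.smul hε.1.le
    have e2 : (c • B - (ε • A + 1)).PosSemidef := by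
      have : c • B - (ε • A + 1) = (c • B - (A + 1)) + (1 - ε) • A := by module
      rw [this]; exact hc.add (hA.posSemidef.smul (sub_nonneg.mpr hε.2))
    have e3 : (1 + ε • A - a • B).PosSemidef := by
      have : 1 + ε • A - a • B = (1 - a • B) + ε • A := by abel
      rw [this]; exact ha1.add hεA.posSemidef
    have e4 : c ≤ c / ε := le_div_self hc0.le hε.1 hε.2
    rw [← frenkelGap_lower (Matrix.isHermitian_one.add hεA.1) hB.posSemidef hεa0 hεa hac e3,
      add_comm, frenkelGap_add_one hεA hB hεa0 (hεa.trans hac) e1 e2,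
      ← frenkelGap_upper hA.1 hB.posSemidef ha hac e4 hcA,
      ← frenkelGap_smul hA hB.1 (div_pos hc0 hε.1) hε.1, mul_div_cancel₀ _ hε.1.ne']
  have hd := hasDerivAt_frenkelGap Matrix.isHermitian_one hB hA.1 ha hac (x₀ := 0)
    (by simpa using Matrix.PosDef.one)
  simp only [zero_smul, add_zero] at hd
  rw [integral_trace_mul_projNonpos_one_sub A hB ha hac ha1 hc1] at hd
  have hl1 : matLog (1 : Matrix n n ℂ) = 0 := by
    simp [matLog, cfc_apply_one]
  rw [hl1, mul_zero, Matrix.trace_zero, Complex.zero_re, sub_zero, sub_self] at hd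
  have hev : (fun x : ℝ => x * frenkelGap B a c A) =ᶠ[𝓝[>] 0]
      fun x : ℝ => frenkelGap B a c (1 + x • A) := by
    filter_upwards [Ioc_mem_nhdsGT (zero_lt_one' ℝ)] with ε hε
    exact (key ε hε).symm
  -- `key` needs `ε > 0`, so the value at `0` comes from continuity, and the slopes are then
  -- compared as one-sided derivatives.
  have h0 : frenkelGap B a c (1 + (0 : ℝ) • A) = 0 := by
    have t1 := hd.continuousAt.tendsto.mono_left (nhdsWithin_le_nhds (s := Set.Ioi 0))
    have t2 : Tendsto (fun x : ℝ => x * frenkelGap B a c A) (𝓝[>] 0) (𝓝 0) :=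
      (Continuous.tendsto' (by fun_prop) 0 0 (by simp)).mono_left nhdsWithin_le_nhds
    exact tendsto_nhds_unique t1 (t2.congr' hev)
  have h1 : HasDerivWithinAt (fun x : ℝ => x * frenkelGap B a c A) 0 (Set.Ioi 0) 0 :=
    hd.hasDerivWithinAt.congr_of_eventuallyEq hev (by simpa using h0.symm)
  have h2 : HasDerivWithinAt (fun x : ℝ => x * frenkelGap B a c A) (frenkelGap B a c A)
      (Set.Ioi 0) 0 := by
    simpa using ((hasDerivAt_id (0 : ℝ)).mul_const (frenkelGap B a c A)).hasDerivWithinAt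
  exact (uniqueDiffWithinAt_Ioi (0 : ℝ)).eq_deriv _ h2 h1

/-- Frenkel's integral formula for positive definite matrices. -/
theorem frenkelGap_eq_zero {A B : Matrix n n ℂ} (hA : A.PosDef) (hB : B.PosDef)
    {a c : ℝ} (ha : 0 < a) (hac : a ≤ c) (haA : (A - a • B).PosSemidef)
    (hcA : (c • B - A).PosSemidef) : frenkelGap B a c A = 0 := by
  obtain ⟨a₁, ha₁, h1⟩ := exists_posSemidef_sub_smul (Matrix.PosDef.one (R := ℂ) (n := n)) hB.1
  obtain ⟨c₁, hc₁, h2⟩ := exists_posSemidef_smul_sub (hA.1.add Matrix.isHermitian_one) hB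
  have hB' := hB.posSemidef
  have haa : min a a₁ ≤ a := min_le_left _ _
  have hcc : c ≤ max c c₁ := le_max_left _ _
  have ha0 : 0 < min a a₁ := lt_min ha ha₁
  -- Widening `[a, c]` leaves the gap unchanged, which makes room for the bounds on `1` and on `A +
  -- 1`.
  rw [← frenkelGap_lower hA.1 hB' ha0 haa hac haA,
    ← frenkelGap_upper hA.1 hB' ha0 (haa.trans hac) hcc hcA]
  exact frenkelGap_eq_zero_of_bounds hA hB ha0 ((haa.trans hac).trans hcc)
    (posSemidef_sub_smul_of_le hB' haA haa)
    (posSemidef_sub_smul_of_le hB' h1 (min_le_right _ _))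
    (posSemidef_smul_sub_of_le hB' h2 (le_max_right _ _))

end Frenkel

/-! ### Part (1): the integral formula for a difference of logarithms -/

section LogIntegral

variable {n : Type*} [Fintype n]

theorem eq_zero_of_re_trace_mul_self {D : Matrix n n ℂ} (hD : D.IsHermitian)
    (h : (D * D).trace.re = 0) : D = 0 := by
  have h1 : 0 ≤ (D.conjTranspose * D).trace :=
    (Matrix.posSemidef_conjTranspose_mul_self D).trace_nonneg
  rw [← Matrix.trace_conjTranspose_mul_self_eq_zero_iff]
  refine Complex.ext ?_ (Complex.nonneg_iff.mp h1).2.symm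
  rw [hD.eq]; exact h

variable [DecidableEq n]

/-- The strict bounds persist for `A + x • H` with small `x`, so the gap is identically zero near `x
= 0` and its derivative vanishes. -/
theorem integral_trace_mul_projNonpos {A B H : Matrix n n ℂ} (hA : A.PosDef) (hB : B.PosDef)
    (hH : H.IsHermitian) {a c : ℝ} (ha : 0 < a) (hac : a ≤ c) (haB : (A - a • B).PosDef)
    (hcB : (c • B - A).PosDef) :
    ∫ γ in a..c, γ⁻¹ * (H * projNonpos (A - γ • B)).trace.re
      = Real.log c * H.trace.re + (H * matLog B).trace.re - (H * matLog A).trace.re := by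
  have hAx : ∀ x : ℝ, (A + x • H).IsHermitian := isHermitian_add_smul hA.1 hH
  have e0 : ∀ᶠ x : ℝ in 𝓝 0, (A + x • H).PosDef :=
    eventually_posDef (a₀ := A) (Continuous.tendsto' (by fun_prop) _ _ (by simp)) hAx hA
  have e1 : ∀ᶠ x : ℝ in 𝓝 0, (A + x • H - a • B).PosDef :=
    eventually_posDef (Continuous.tendsto' (by fun_prop) _ _ (by simp))
      (fun x => isHermitian_sub_smul (hAx x) hB.1 a) haB
  have e2 : ∀ᶠ x : ℝ in 𝓝 0, (c • B - (A + x • H)).PosDef :=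
    eventually_posDef (Continuous.tendsto' (by fun_prop) _ _ (by simp))
      (fun x => (isHermitian_smul hB.1 c).sub (hAx x)) hcB
  have hd := hasDerivAt_frenkelGap hA.1 hB hH ha hac (x₀ := 0) (by simpa using hA)
  have hz : HasDerivAt (fun x : ℝ => frenkelGap B a c (A + x • H)) 0 0 := by
    refine (hasDerivAt_const (0 : ℝ) (0 : ℝ)).congr_of_eventuallyEq ?_
    filter_upwards [e0, e1, e2] with x h0 h1 h2
    exact frenkelGap_eq_zero h0 hB ha hac h1.posSemidef h2.posSemidef
  have h := hd.unique hz
  simp only [zero_smul, add_zero] at h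
  linarith

open scoped Matrix.Norms.L2Operator in
theorem aestronglyMeasurable_projNonpos {A B : Matrix n n ℂ} (hA : A.IsHermitian)
    (hB : B.PosDef) : AEStronglyMeasurable (fun γ : ℝ => projNonpos (A - γ • B)) volume :=
  aestronglyMeasurable_of_continuousAt_compl (finite_not_isUnit_sub_smul A hB).countable
    fun _ hγ => continuousAt_projNonpos_sub_smul hA hB.1 (not_not.mp hγ)

open scoped Matrix.Norms.L2Operator in
theorem intervalIntegrable_inv_smul_projNonpos {A B : Matrix n n ℂ} (hA : A.IsHermitian)
    (hB : B.PosDef) {a c : ℝ} (ha : 0 < a) (hac : a ≤ c) :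
    IntervalIntegrable (fun γ : ℝ => γ⁻¹ • projNonpos (A - γ • B)) volume a c := by
  rw [intervalIntegrable_iff_integrableOn_Ioc_of_le hac]
  refine Integrable.mono' (g := fun _ => a⁻¹ * 1) (integrable_const _) ?_ ?_
  · exact (measurable_inv.aestronglyMeasurable.smul
      (aestronglyMeasurable_projNonpos hA hB)).restrict
  · filter_upwards [ae_restrict_mem measurableSet_Ioc] with x hx
    have hx0 : 0 < x := ha.trans hx.1
    rw [norm_smul, norm_inv, Real.norm_of_nonneg hx0.le]
    exact mul_le_mul (inv_anti₀ ha hx.1.le) (norm_projNonpos_le _) (norm_nonneg _)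
      (inv_nonneg.mpr ha.le)

open scoped Matrix.Norms.L2Operator in
-- The difference `D` of the two sides is Hermitian. Testing the scalar identity with `H = D` gives
-- `Tr D² = 0`.
theorem integral_inv_smul_projNonpos {A B : Matrix n n ℂ} (hA : A.PosDef) (hB : B.PosDef)
    {a c : ℝ} (ha : 0 < a) (hac : a ≤ c) (haB : (A - a • B).PosDef) (hcB : (c • B - A).PosDef) :
    ∫ γ in a..c, γ⁻¹ • projNonpos (A - γ • B)
      = Real.log c • (1 : Matrix n n ℂ) + matLog B - matLog A := by
  set I := ∫ γ in a..c, γ⁻¹ • projNonpos (A - γ • B) with hI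
  have hint := intervalIntegrable_inv_smul_projNonpos hA.1 hB ha hac
  have hlog : ∀ X : Matrix n n ℂ, (matLog X).IsHermitian := fun X =>
    cfc_predicate (R := ℝ) (p := IsSelfAdjoint) _ X
  have hIH : I.IsHermitian := by
    have h := ContinuousLinearMap.intervalIntegral_comp_comm
      (starL' ℝ : Matrix n n ℂ ≃L[ℝ] Matrix n n ℂ).toContinuousLinearMap hint
    refine (h.symm.trans ?_ : star I = I)
    refine intervalIntegral.integral_congr fun γ _ => ?_
    exact isHermitian_smul (isHermitian_projNonpos (A - γ • B)) γ⁻¹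
  have htr : ∀ H : Matrix n n ℂ, (H * I).trace.re
      = ∫ γ in a..c, γ⁻¹ * (H * projNonpos (A - γ • B)).trace.re := by
    intro H
    have h := ContinuousLinearMap.intervalIntegral_comp_comm
      (reTraceMul H).toContinuousLinearMap hint
    refine (h.symm.trans ?_ : reTraceMul H I = _)
    refine intervalIntegral.integral_congr fun γ _ => ?_
    exact (reTraceMul H).map_smul γ⁻¹ _
  have hDH : (I - (Real.log c • (1 : Matrix n n ℂ) + matLog B - matLog A)).IsHermitian :=
    hIH.sub (((isHermitian_smul Matrix.isHermitian_one _).add (hlog B)).sub (hlog A))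
  rw [← sub_eq_zero]
  refine eq_zero_of_re_trace_mul_self hDH ?_
  set D := I - (Real.log c • (1 : Matrix n n ℂ) + matLog B - matLog A) with hD
  have h := integral_trace_mul_projNonpos hA hB hDH ha hac haB hcB
  rw [← htr] at h
  have e : (D * D).trace.re = (D * I).trace.re - (Real.log c * D.trace.re +
      (D * matLog B).trace.re - (D * matLog A).trace.re) := by
    nth_rewrite 2 [hD]
    simp [mul_sub, mul_add]
  rw [e, h, sub_self]

open scoped Matrix.Norms.L2Operator in
theorem hasRSIntegral_log_projGT {A B : Matrix n n ℂ} (hA : A.IsHermitian) (hB : B.PosDef)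
    {a b : ℝ} (ha : 0 < a) (hab : a < b) :
    HasRSIntegral Real.log (fun γ : ℝ => projGT A (γ • B)) a b
      (Real.log b • projGT A (b • B) - Real.log a • projGT A (a • B)
        - ∫ γ in a..b, γ⁻¹ • projGT A (γ • B)) := by
  have hF : ∀ γ : ℝ, projGT A (γ • B) = 1 - projNonpos (A - γ • B) := fun γ =>
    projGT_eq (isHermitian_sub_smul hA hB.1 γ)
  refine hasRSIntegral_of_ae_continuousAt (F := fun γ : ℝ => projGT A (γ • B)) (g' := fun γ => γ⁻¹)
    (C := ‖(1 : Matrix n n ℂ)‖ + 1) hab ?_ ?_ ?_ ?_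
  · exact intervalIntegral.intervalIntegrable_inv (fun x hx => by
      rw [Set.uIcc_of_le hab.le] at hx; exact (ha.trans_le hx.1).ne') continuousOn_id
  · intro s hs t ht
    have hs0 := ha.trans_le hs.1
    have ht0 := ha.trans_le ht.1
    rw [integral_inv_of_pos hs0 ht0, Real.log_div ht0.ne' hs0.ne']
  · intro t _
    rw [hF]
    exact (norm_sub_le _ _).trans (by gcongr; exact norm_projNonpos_le _)
  · filter_upwards [(finite_not_isUnit_sub_smul A hB).countable.ae_notMem volume] with γ hγ _
    simp only [hF]
    exact continuousAt_const.sub (continuousAt_projNonpos_sub_smul hA hB.1 (not_not.mp hγ))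

open scoped Matrix.Norms.L2Operator in
theorem hasRSIntegralIoi_log_projGT {A B : Matrix n n ℂ} (hA : A.PosDef) (hB : B.PosDef) :
    HasRSIntegralIoi Real.log (fun γ : ℝ => projGT A (γ • B)) (matLog B - matLog A) := by
  refine ⟨_, fun a b ha hab => hasRSIntegral_log_projGT hA.1 hB ha hab, ?_⟩
  obtain ⟨a₀, ha₀, h1⟩ := exists_posSemidef_sub_smul hA hB.1
  obtain ⟨c₀, hc₀, h2⟩ := exists_posSemidef_smul_sub hA.1 hB
  -- For `a` small and `b` large the projection is `1` at `a` and `0` at `b`, and the truncated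
  -- integral already equals its limit.
  refine tendsto_const_nhds.congr' ?_
  have hev : ∀ᶠ p : ℝ × ℝ in 𝓝[>] (0 : ℝ) ×ˢ atTop,
      p.1 ∈ Set.Ioo 0 (min a₀ c₀) ∧ p.2 ∈ Set.Ioi c₀ :=
    prod_mem_prod (Ioo_mem_nhdsGT (lt_min ha₀ hc₀)) (Ioi_mem_atTop c₀)
  filter_upwards [hev] with ⟨a, b⟩ ⟨ha, hb⟩
  have ha1 : a < a₀ := ha.2.trans_le (min_le_left _ _)
  have hab : a < b := (ha.2.trans_le (min_le_right _ _)).trans hb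
  have hb0 : 0 < b := ha.1.trans hab
  have haB : (A - a • B).PosDef := by
    have : A - a • B = (A - a₀ • B) + (a₀ - a) • B := by module
    rw [this]; exact Matrix.PosDef.posSemidef_add h1 (hB.smul (sub_pos.mpr ha1))
  have hbB : (b • B - A).PosDef := by
    have : b • B - A = (c₀ • B - A) + (b - c₀) • B := by module
    rw [this]; exact Matrix.PosDef.posSemidef_add h2 (hB.smul (sub_pos.mpr hb))
  have hF : ∀ γ : ℝ, projGT A (γ • B) = 1 - projNonpos (A - γ • B) := fun γ =>
    projGT_eq (isHermitian_sub_smul hA.1 hB.1 γ)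
  simp only [hF, smul_sub]
  rw [projNonpos_of_posDef haB, projNonpos_of_neg (by rw [neg_sub]; exact hbB.posSemidef),
    intervalIntegral.integral_sub _
      (intervalIntegrable_inv_smul_projNonpos hA.1 hB ha.1 hab.le),
    integral_inv_smul_projNonpos hA hB ha.1 hab.le haB hbB,
    intervalIntegral.integral_smul_const, integral_inv_of_pos ha.1 hb0,
    Real.log_div hb0.ne' ha.1.ne']
  · module
  · rw [intervalIntegrable_iff_integrableOn_Ioc_of_le hab.le]
    refine Integrable.smul_const ?_ _
    refine (intervalIntegrable_iff_integrableOn_Ioc_of_le hab.le).mp ?_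
    exact intervalIntegral.intervalIntegrable_inv (fun x hx => by
      rw [Set.uIcc_of_le hab.le] at hx; exact (ha.1.trans_le hx.1).ne') continuousOn_id

end LogIntegral

/-! ### Frenkel's formula for singular matrices, and supports -/

section RelativeEntropy

variable {n : Type*} [Fintype n] [DecidableEq n]

theorem specWeight_self {X : Matrix n n ℂ} (hX : X.IsHermitian) (i : n) :
    specWeight hX X i = hX.eigenvalues i := by
  have h := hX.conjStarAlgAut_star_eigenvectorUnitary
  rw [Unitary.conjStarAlgAut_apply] at h
  have h2 : star (hX.eigenvectorUnitary : Matrix n n ℂ) * X *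
      (hX.eigenvectorUnitary : Matrix n n ℂ) = Matrix.diagonal (RCLike.ofReal ∘ hX.eigenvalues) := by
    simpa using h
  rw [specWeight, h2]
  simp

theorem specWeight_le_of_posSemidef_smul_sub {ρ σ : Matrix n n ℂ} (hσ : σ.IsHermitian) {c : ℝ}
    (h : (c • σ - ρ).PosSemidef) (i : n) : specWeight hσ ρ i ≤ c * hσ.eigenvalues i := by
  have h1 := specWeight_nonneg hσ h i
  have h2 : specWeight hσ (c • σ - ρ) i = c * specWeight hσ σ i - specWeight hσ ρ i := by
    simp [specWeight, mul_sub, sub_mul]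
  rw [h2, specWeight_self] at h1
  linarith

theorem matLog_add_smul_one {X : Matrix n n ℂ} (hX : X.IsHermitian) (t : ℝ) :
    matLog (X + t • (1 : Matrix n n ℂ)) = cfc (fun x => Real.log (x + t)) X := by
  have h := sub_smul_one_eq_cfc hX (-t)
  rw [neg_smul, sub_neg_eq_add] at h
  rw [matLog, h, cfc_cfc _ _ hX]
  simp only [sub_neg_eq_add]

/-- In an eigenbasis of `σ`, the bound `ρ ≤ cσ` removes the weight of `ρ` on the kernel of `σ`.
Kernel terms become `t log t → 0`, and the others are continuous at `t = 0`. -/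
theorem tendsto_trace_mul_matLog_add {ρ σ : Matrix n n ℂ} (hρ : ρ.PosSemidef)
    (hσ : σ.PosSemidef) {c : ℝ} (hc : (c • σ - ρ).PosSemidef) :
    Tendsto (fun t : ℝ => ((ρ + t • (1 : Matrix n n ℂ)) *
      matLog (σ + t • (1 : Matrix n n ℂ))).trace.re) (𝓝 0) (𝓝 (ρ * matLog σ).trace.re) := by
  have h1 : ∀ t : ℝ, ((ρ + t • (1 : Matrix n n ℂ)) *
      matLog (σ + t • (1 : Matrix n n ℂ))).trace.re
      = ∑ i, (specWeight hσ.1 ρ i + t) * Real.log (hσ.1.eigenvalues i + t) := by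
    intro t
    rw [matLog_add_smul_one hσ.1, trace_mul_cfc hσ.1]
    refine Finset.sum_congr rfl fun i _ => ?_
    have : specWeight hσ.1 (ρ + t • (1 : Matrix n n ℂ)) i
        = specWeight hσ.1 ρ i + t * specWeight hσ.1 1 i := by
      simp [specWeight, mul_add, add_mul]
    rw [this, specWeight_one, mul_one]
  simp only [h1]
  rw [matLog, trace_mul_cfc hσ.1]
  refine tendsto_finsetSum _ fun i _ => ?_
  rcases (hσ.eigenvalues_nonneg i).eq_or_lt with h0 | hpos
  · have hw : specWeight hσ.1 ρ i = 0 := by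
      refine le_antisymm ?_ (specWeight_nonneg hσ.1 hρ i)
      have := specWeight_le_of_posSemidef_smul_sub hσ.1 hc i
      rwa [← h0, mul_zero] at this
    rw [hw, ← h0]
    simp only [zero_add, zero_mul]
    exact Real.continuous_mul_log.tendsto' 0 0 (by simp)
  · have hcont : ContinuousAt (fun t : ℝ => (specWeight hσ.1 ρ i + t) *
        Real.log (hσ.1.eigenvalues i + t)) 0 := by
      refine ContinuousAt.mul (by fun_prop) (ContinuousAt.log (by fun_prop) ?_)
      simpa using hpos.ne'
    simpa using hcont.tendsto

theorem tendsto_trace_mul_matLog_self {X : Matrix n n ℂ} (hX : X.IsHermitian) :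
    Tendsto (fun t : ℝ => ((X + t • (1 : Matrix n n ℂ)) *
      matLog (X + t • (1 : Matrix n n ℂ))).trace.re) (𝓝 0) (𝓝 (X * matLog X).trace.re) := by
  have hXt := isHermitian_add_smul hX Matrix.isHermitian_one
  simp only [matLog, mul_cfc_self (hXt _), mul_cfc_self hX]
  have h := tendsto_cfc_of_isOpen (f := fun x => x * Real.log x) (l := 𝓝 (0 : ℝ)) isOpen_univ
    Real.continuous_mul_log.continuousOn
    (Continuous.tendsto' (f := fun t : ℝ => X + t • (1 : Matrix n n ℂ)) (by fun_prop) 0 X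
      (by simp)) (Eventually.of_forall hXt) hX (Set.subset_univ _)
  simpa [Function.comp_def] using ((continuous_reTraceMul 1).tendsto _).comp h

theorem negTrace_sub_smul_le {A B : Matrix n n ℂ} (hA : A.PosSemidef) (hB : B.PosSemidef)
    {γ : ℝ} (hγ : 0 ≤ γ) : negTrace (A - γ • B) ≤ γ * B.trace.re := by
  have hX := isHermitian_sub_smul hA.1 hB.1 γ
  have h1 := trace_mul_projNonpos_nonneg hX hA
  have h2 := mul_le_mul_of_nonneg_left (trace_mul_projNonpos_le hX hB) hγ
  have h3 : negTrace (A - γ • B) = γ * (B * projNonpos (A - γ • B)).trace.re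
      - (A * projNonpos (A - γ • B)).trace.re := by
    rw [negTrace, sub_mul]; simp
  linarith

theorem abs_inv_mul_negTrace_le {A B : Matrix n n ℂ} (hA : A.PosSemidef) (hB : B.PosSemidef)
    {γ : ℝ} (hγ : 0 < γ) : ‖γ⁻¹ * negTrace (A - γ • B)‖ ≤ B.trace.re := by
  rw [Real.norm_of_nonneg (mul_nonneg (inv_nonneg.mpr hγ.le)
    (negTrace_nonneg (isHermitian_sub_smul hA.1 hB.1 γ))), inv_mul_le_iff₀ hγ]
  exact negTrace_sub_smul_le hA hB hγ.le

theorem aestronglyMeasurable_inv_mul_negTrace {A B : Matrix n n ℂ} (hA : A.IsHermitian)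
    (hB : B.IsHermitian) :
    AEStronglyMeasurable (fun γ : ℝ => γ⁻¹ * negTrace (A - γ • B)) volume :=
  (measurable_inv.mul (continuous_negTrace_sub_smul hA hB).measurable).aestronglyMeasurable

theorem intervalIntegrable_zero_inv_mul_negTrace {A B : Matrix n n ℂ} (hA : A.PosSemidef)
    (hB : B.PosSemidef) {c : ℝ} (hc : 0 ≤ c) :
    IntervalIntegrable (fun γ : ℝ => γ⁻¹ * negTrace (A - γ • B)) volume 0 c := by
  rw [intervalIntegrable_iff_integrableOn_Ioc_of_le hc]
  refine Integrable.mono' (g := fun _ => B.trace.re) (integrable_const _)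
    (aestronglyMeasurable_inv_mul_negTrace hA.1 hB.1).restrict ?_
  filter_upwards [ae_restrict_mem measurableSet_Ioc] with x hx
  exact abs_inv_mul_negTrace_le hA hB hx.1

theorem integral_negTrace_of_posDef {A B : Matrix n n ℂ} (hA : A.PosDef) (hB : B.PosDef)
    {c : ℝ} (hc : 0 < c) (hcB : (c • B - A).PosSemidef) :
    ∫ γ in (0 : ℝ)..c, γ⁻¹ * negTrace (A - γ • B) = (A * matLog A).trace.re
      - (A * matLog B).trace.re - Real.log c * A.trace.re + c * B.trace.re - A.trace.re := by
  obtain ⟨a₀, ha₀, h₀⟩ := exists_posSemidef_sub_smul hA hB.1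
  have ha : 0 < min a₀ c := lt_min ha₀ hc
  have haB := posSemidef_sub_smul_of_le hB.posSemidef h₀ (min_le_left a₀ c)
  have h := frenkelGap_eq_zero hA hB ha (min_le_right a₀ c) haB hcB
  rw [frenkelGap, sub_eq_zero] at h
  have hz : ∫ γ in (0 : ℝ)..(min a₀ c), γ⁻¹ * negTrace (A - γ • B)
      = ∫ γ in (0 : ℝ)..(min a₀ c), (0 : ℝ) := by
    refine intervalIntegral.integral_congr fun γ hγ => ?_
    rw [Set.uIcc_of_le ha.le] at hγ
    rw [negTrace_of_posSemidef (posSemidef_sub_smul_of_le hB.posSemidef haB hγ.2), mul_zero]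
  rw [← intervalIntegral.integral_add_adjacent_intervals
    (intervalIntegrable_zero_inv_mul_negTrace hA.posSemidef hB.posSemidef ha.le)
    (intervalIntegrable_inv_mul_negTrace hA.1 hB.1 ha hc), hz, h]
  simp

/-- Frenkel's integral formula for positive semidefinite matrices with `ρ ≤ c σ`. -/
theorem integral_negTrace_of_posSemidef {ρ σ : Matrix n n ℂ} (hρ : ρ.PosSemidef)
    (hσ : σ.PosSemidef) {c : ℝ} (hc : 1 ≤ c) (hcB : (c • σ - ρ).PosSemidef) :
    ∫ γ in (0 : ℝ)..c, γ⁻¹ * negTrace (ρ - γ • σ) = (ρ * matLog ρ).trace.re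
      - (ρ * matLog σ).trace.re - Real.log c * ρ.trace.re + c * σ.trace.re - ρ.trace.re := by
  have hc0 : 0 < c := zero_lt_one.trans_le hc
  have hpos : ∀ {X : Matrix n n ℂ}, X.PosSemidef → ∀ t : ℝ, 0 < t →
      (X + t • (1 : Matrix n n ℂ)).PosDef := fun hX t ht =>
    Matrix.PosDef.posSemidef_add hX (Matrix.PosDef.one.smul ht)
  have htr : ∀ X : Matrix n n ℂ, Tendsto (fun t : ℝ => (X + t • (1 : Matrix n n ℂ)).trace.re)
      (𝓝 0) (𝓝 X.trace.re) := fun X =>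
    Continuous.tendsto' (Complex.continuous_re.comp
      (Continuous.matrix_trace (by fun_prop))) _ _ (by simp)
  have hR : Tendsto (fun t : ℝ =>
      ((ρ + t • (1 : Matrix n n ℂ)) * matLog (ρ + t • (1 : Matrix n n ℂ))).trace.re
      - ((ρ + t • (1 : Matrix n n ℂ)) * matLog (σ + t • (1 : Matrix n n ℂ))).trace.re
      - Real.log c * (ρ + t • (1 : Matrix n n ℂ)).trace.re
      + c * (σ + t • (1 : Matrix n n ℂ)).trace.re - (ρ + t • (1 : Matrix n n ℂ)).trace.re)
      (𝓝[>] 0) (𝓝 ((ρ * matLog ρ).trace.re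
      - (ρ * matLog σ).trace.re - Real.log c * ρ.trace.re + c * σ.trace.re - ρ.trace.re)) :=
    ((((((tendsto_trace_mul_matLog_self hρ.1).sub (tendsto_trace_mul_matLog_add hρ hσ hcB)).sub
      ((htr ρ).const_mul _)).add ((htr σ).const_mul _)).sub (htr ρ))).mono_left nhdsWithin_le_nhds
  have hL : Tendsto (fun t : ℝ => ∫ γ in (0 : ℝ)..c,
      γ⁻¹ * negTrace (ρ + t • (1 : Matrix n n ℂ) - γ • (σ + t • (1 : Matrix n n ℂ))))
      (𝓝[>] 0) (𝓝 (∫ γ in (0 : ℝ)..c, γ⁻¹ * negTrace (ρ - γ • σ))) := by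
    refine intervalIntegral.tendsto_integral_filter_of_dominated_convergence
      (fun _ => (σ + (1 : ℝ) • (1 : Matrix n n ℂ)).trace.re) ?_ ?_ (by simp) ?_
    · filter_upwards [self_mem_nhdsWithin] with t ht
      exact (aestronglyMeasurable_inv_mul_negTrace (hpos hρ t ht).1 (hpos hσ t ht).1).restrict
    · filter_upwards [Ioc_mem_nhdsGT (zero_lt_one' ℝ)] with t ht
      refine Eventually.of_forall fun γ hγ => ?_
      rw [Set.uIoc_of_le hc0.le] at hγ
      refine (abs_inv_mul_negTrace_le (hpos hρ t ht.1).posSemidef (hpos hσ t ht.1).posSemidef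
        hγ.1).trans ?_
      simp only [Matrix.trace_add, Matrix.trace_smul, Matrix.trace_one, Complex.add_re,
        Complex.real_smul, Complex.re_ofReal_mul]
      have : (0 : ℝ) ≤ ((Fintype.card n : ℂ)).re := by simp
      gcongr
      exact ht.2
    · refine Eventually.of_forall fun γ _ => Tendsto.const_mul _ ?_
      refine (tendsto_negTrace (l := 𝓝 (0 : ℝ)) (a := fun t : ℝ =>
        ρ + t • (1 : Matrix n n ℂ) - γ • (σ + t • (1 : Matrix n n ℂ)))
        (Continuous.tendsto' (by fun_prop) 0 _ (by simp)) (fun t => ?_)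
        (isHermitian_sub_smul hρ.1 hσ.1 γ)).mono_left nhdsWithin_le_nhds
      exact isHermitian_sub_smul (isHermitian_add_smul hρ.1 Matrix.isHermitian_one t)
        (isHermitian_add_smul hσ.1 Matrix.isHermitian_one t) γ
  refine tendsto_nhds_unique hL (hR.congr' ?_)
  filter_upwards [self_mem_nhdsWithin] with t ht
  refine (integral_negTrace_of_posDef (hpos hρ t ht) (hpos hσ t ht) hc0 ?_).symm
  -- The assumption `1 ≤ c` keeps the domination when both matrices are shifted by the same `t • 1`.
  have : c • (σ + t • (1 : Matrix n n ℂ)) - (ρ + t • (1 : Matrix n n ℂ))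
      = (c • σ - ρ) + ((c - 1) * t) • (1 : Matrix n n ℂ) := by module
  rw [this]
  exact hcB.add (Matrix.PosSemidef.one.smul (mul_nonneg (sub_nonneg.mpr hc) (le_of_lt ht)))

/-- Domination gives `ker σ ⊆ ker ρ`. With `Z` the projection onto `ker σ`, this yields `Z ρ = 0`,
so `ρ = σ σ⁺ ρ` with `σ⁺` the pseudoinverse, obtained from `x⁻¹` with `0⁻¹ = 0`. -/
theorem range_mulVecLin_le_of_posSemidef_smul_sub {ρ σ : Matrix n n ℂ} (hρ : ρ.PosSemidef)
    (hσ : σ.PosSemidef) {c : ℝ} (hc : (c • σ - ρ).PosSemidef) :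
    LinearMap.range ρ.mulVecLin ≤ LinearMap.range σ.mulVecLin := by
  classical
  have hker : ∀ v : n → ℂ, σ.mulVec v = 0 → ρ.mulVec v = 0 := by
    intro v hv
    rw [← hρ.dotProduct_mulVec_zero_iff]
    have h1 := hc.dotProduct_mulVec_nonneg v
    rw [Matrix.sub_mulVec, Matrix.smul_mulVec, hv, smul_zero, zero_sub, dotProduct_neg] at h1
    exact le_antisymm (neg_nonneg.mp h1) (hρ.dotProduct_mulVec_nonneg v)
  set Z : Matrix n n ℂ := cfc (fun x : ℝ => if x = 0 then (1 : ℝ) else 0) σ with hZ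
  have hZH : Z.IsHermitian := cfc_predicate (R := ℝ) (p := IsSelfAdjoint) _ σ
  have hσZ : σ * Z = 0 := by
    rw [hZ, mul_cfc_self hσ.1, ← cfc_const_zero ℝ σ]
    refine cfc_congr fun x _ => ?_
    by_cases h : x = 0 <;> simp [h]
  have hρZ : ρ * Z = 0 := by
    refine Matrix.ext_of_mulVec_single fun i => ?_
    rw [← Matrix.mulVec_mulVec, Matrix.zero_mulVec]
    exact hker _ (by rw [Matrix.mulVec_mulVec, hσZ, Matrix.zero_mulVec])
  have hZρ : Z * ρ = 0 := by
    have := congrArg Matrix.conjTranspose hρZ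
    rwa [Matrix.conjTranspose_mul, hρ.1.eq, hZH.eq, Matrix.conjTranspose_zero] at this
  have hinv : σ * cfc (fun x : ℝ => x⁻¹) σ = 1 - Z := by
    rw [mul_cfc_self hσ.1, ← cfc_one_hermitian hσ.1, hZ,
      ← cfc_sub _ _ _ (continuousOn_spectrum _ _) (continuousOn_spectrum _ _)]
    refine cfc_congr fun x _ => ?_
    by_cases h : x = 0 <;> simp [h]
  have hfac : ρ = σ * (cfc (fun x : ℝ => x⁻¹) σ * ρ) := by
    rw [← Matrix.mul_assoc, hinv, sub_mul, hZρ, sub_zero, Matrix.one_mul]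
  rw [hfac, Matrix.mulVecLin_mul]
  exact LinearMap.range_comp_le_range _ _

end RelativeEntropy

/-! ### Part (2): integrals against `P` and `Q` -/

section States

variable {n : Type*} {ρ σ : Matrix n n ℂ}

theorem exists_posSemidef_of_dMax_lt_top (h : dMax ρ σ < ⊤) :
    ∃ c : ℝ, (c • σ - ρ).PosSemidef := by
  obtain ⟨_, ⟨l, hl, rfl⟩, -⟩ := sInf_lt_iff.mp h
  exact ⟨Real.exp l, hl⟩

variable [Fintype n] [DecidableEq n]

theorem negTrace_eq_distQ_sub_distP (γ : ℝ) :
    negTrace (ρ - γ • σ) = γ * distQ ρ σ γ - distP ρ σ γ := by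
  rw [negTrace, distP, distQ, projLE_eq, sub_mul]
  simp

theorem distQ_nonneg (hρ : ρ.IsHermitian) (hσ : σ.PosSemidef) (γ : ℝ) : 0 ≤ distQ ρ σ γ :=
  trace_mul_projNonpos_nonneg (isHermitian_sub_smul hρ hσ.1 γ) hσ

theorem distQ_le (hρ : ρ.IsHermitian) (hσ : σ.PosSemidef) (γ : ℝ) : distQ ρ σ γ ≤ σ.trace.re :=
  trace_mul_projNonpos_le (isHermitian_sub_smul hρ hσ.1 γ) hσ

theorem distP_nonneg (hρ : ρ.PosSemidef) (hσ : σ.IsHermitian) (γ : ℝ) : 0 ≤ distP ρ σ γ :=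
  trace_mul_projNonpos_nonneg (isHermitian_sub_smul hρ.1 hσ γ) hρ

theorem distP_le (hρ : ρ.PosSemidef) (hσ : σ.IsHermitian) (γ : ℝ) : distP ρ σ γ ≤ ρ.trace.re :=
  trace_mul_projNonpos_le (isHermitian_sub_smul hρ.1 hσ γ) hρ

/-- `Q` is a subgradient of `N(γ) = negTrace (ρ - γ • σ)`. Hence `Q` is monotone, has countably many
discontinuities, and equals `N'` elsewhere, even when `σ` is singular. -/
theorem negTrace_subgradient (hρ : ρ.IsHermitian) (hσ : σ.IsHermitian) (γ γ' : ℝ) :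
    negTrace (ρ - γ • σ) + (γ' - γ) * distQ ρ σ γ ≤ negTrace (ρ - γ' • σ) := by
  have h := negTrace_add_le (isHermitian_sub_smul hρ hσ γ) (isHermitian_sub_smul hρ hσ γ')
  have e : ρ - γ' • σ - (ρ - γ • σ) = (γ - γ') • σ := by module
  rw [e, Matrix.smul_mul, Matrix.trace_smul, Complex.real_smul, Complex.re_ofReal_mul] at h
  rw [distQ, projLE_eq]
  linarith

theorem monotone_distQ (hρ : ρ.IsHermitian) (hσ : σ.IsHermitian) : Monotone (distQ ρ σ) := by
  intro γ γ' h
  rcases h.eq_or_lt with rfl | hlt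
  · exact le_rfl
  have h1 := negTrace_subgradient hρ hσ γ γ'
  have h2 := negTrace_subgradient hρ hσ γ' γ
  by_contra! hcon
  nlinarith [mul_pos (sub_pos.mpr hlt) (sub_pos.mpr hcon)]

theorem hasDerivAt_negTrace (hρ : ρ.IsHermitian) (hσ : σ.IsHermitian) {γ : ℝ}
    (hγ : ContinuousAt (distQ ρ σ) γ) :
    HasDerivAt (fun γ : ℝ => negTrace (ρ - γ • σ)) (distQ ρ σ γ) γ :=
  hasDerivAt_of_subgradient (Eventually.of_forall fun _ => negTrace_subgradient hρ hσ _ _)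
    (Eventually.of_forall fun _ => negTrace_subgradient hρ hσ _ _) hγ

theorem continuousAt_distP (hρ : ρ.IsHermitian) (hσ : σ.IsHermitian) {γ : ℝ}
    (hγ : ContinuousAt (distQ ρ σ) γ) : ContinuousAt (distP ρ σ) γ := by
  have : distP ρ σ = fun γ => γ * distQ ρ σ γ - negTrace (ρ - γ • σ) := by
    ext γ; rw [negTrace_eq_distQ_sub_distP]; ring
  rw [this]
  exact (continuousAt_id.mul hγ).sub (continuous_negTrace_sub_smul hρ hσ).continuousAt

theorem countable_not_continuousAt_distQ (hρ : ρ.IsHermitian) (hσ : σ.IsHermitian) :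
    {γ | ¬ ContinuousAt (distQ ρ σ) γ}.Countable :=
  (monotone_distQ hρ hσ).countable_not_continuousAt

/-- From `N = γQ - P` one gets `P/γ = Q - N/γ`, and `Q` integrates to the increment of `N`. -/
theorem integral_inv_mul_distP (hρ : ρ.IsHermitian) (hσ : σ.IsHermitian) {a b : ℝ} (ha : 0 < a)
    (hab : a ≤ b) : ∫ γ in a..b, γ⁻¹ • distP ρ σ γ = negTrace (ρ - b • σ) - negTrace (ρ - a • σ)
      - ∫ γ in a..b, γ⁻¹ * negTrace (ρ - γ • σ) := by
  have hQ : IntervalIntegrable (distQ ρ σ) volume a b := (monotone_distQ hρ hσ).intervalIntegrable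
  have h1 : ∫ γ in a..b, distQ ρ σ γ = negTrace (ρ - b • σ) - negTrace (ρ - a • σ) :=
    integral_eq_of_hasDerivAt_off_countable_of_le (fun γ : ℝ => negTrace (ρ - γ • σ)) _ hab
      (countable_not_continuousAt_distQ hρ hσ) (continuous_negTrace_sub_smul hρ hσ).continuousOn
      (fun γ hγ => hasDerivAt_negTrace hρ hσ (not_not.mp hγ.2)) hQ
  rw [← h1, ← intervalIntegral.integral_sub hQ
    (intervalIntegrable_inv_mul_negTrace hρ hσ ha (ha.trans_le hab))]
  refine intervalIntegral.integral_congr fun γ hγ => ?_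
  rw [Set.uIcc_of_le hab] at hγ
  have hγ0 : γ ≠ 0 := (ha.trans_le hγ.1).ne'
  change γ⁻¹ * distP ρ σ γ = distQ ρ σ γ - γ⁻¹ * negTrace (ρ - γ • σ)
  rw [negTrace_eq_distQ_sub_distP]
  field_simp
  ring

theorem intervalIntegrable_one_add_log (a b : ℝ) :
    IntervalIntegrable (fun γ => 1 + Real.log γ) volume a b :=
  intervalIntegrable_const.add intervalIntegral.intervalIntegrable_log'

/-- The fundamental theorem of calculus for `(1 + log γ) N(γ)`, whose derivative off a countable set
is `(1 + log γ) Q + N/γ`. -/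
theorem integral_one_add_log_mul_distQ (hρ : ρ.PosSemidef) (hσ : σ.PosSemidef) {b : ℝ}
    (hb : 0 < b) : ∫ γ in (0 : ℝ)..b, (1 + Real.log γ) • distQ ρ σ γ =
      (1 + Real.log b) * negTrace (ρ - b • σ)
      - ∫ γ in (0 : ℝ)..b, γ⁻¹ * negTrace (ρ - γ • σ) := by
  have hE := intervalIntegrable_zero_inv_mul_negTrace hρ hσ hb.le
  have hQ : IntervalIntegrable (fun γ => (1 + Real.log γ) * distQ ρ σ γ) volume 0 b := by
    rw [intervalIntegrable_iff_integrableOn_Ioc_of_le hb.le]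
    refine Integrable.mul_bdd (c := σ.trace.re)
      ((intervalIntegrable_iff_integrableOn_Ioc_of_le hb.le).mp
      (intervalIntegrable_one_add_log 0 b))
      (monotone_distQ hρ.1 hσ.1).measurable.aestronglyMeasurable
      (Eventually.of_forall fun γ => ?_)
    rw [Real.norm_of_nonneg (distQ_nonneg hρ.1 hσ γ)]
    exact distQ_le hρ.1 hσ γ
  -- At `0` the logarithm is tamed by `0 ≤ N(γ) ≤ γ Tr σ`. The value there is `0` because `N(0) =
  -- 0`, whatever `Real.log 0` is.
  have hcont : ContinuousOn (fun γ : ℝ => (1 + Real.log γ) * negTrace (ρ - γ • σ))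
      (Set.Icc 0 b) := by
    intro γ hγ
    rcases hγ.1.eq_or_lt with rfl | hpos
    · have h0 : negTrace (ρ - (0 : ℝ) • σ) = 0 := by
        rw [zero_smul, sub_zero]; exact negTrace_of_posSemidef hρ
      have hlim : Tendsto (fun γ : ℝ => |γ + γ * Real.log γ| * σ.trace.re)
          (𝓝[Set.Icc 0 b] 0) (𝓝 0) :=
        (Continuous.tendsto' ((continuous_id.add Real.continuous_mul_log).abs.mul
          continuous_const) 0 0 (by simp)).mono_left nhdsWithin_le_nhds
      rw [ContinuousWithinAt, h0, mul_zero]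
      refine squeeze_zero_norm' ?_ hlim
      filter_upwards [self_mem_nhdsWithin] with γ hγ
      have h1 := negTrace_sub_smul_le hρ hσ hγ.1
      have h2 := negTrace_nonneg (isHermitian_sub_smul hρ.1 hσ.1 γ)
      have h3 : γ + γ * Real.log γ = γ * (1 + Real.log γ) := by ring
      rw [norm_mul, Real.norm_of_nonneg h2, Real.norm_eq_abs, h3, abs_mul, abs_of_nonneg hγ.1]
      calc |1 + Real.log γ| * negTrace (ρ - γ • σ) ≤ |1 + Real.log γ| * (γ * σ.trace.re) := by
            gcongr
        _ = γ * |1 + Real.log γ| * σ.trace.re := by ring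
    · exact ((continuousAt_const.add (Real.continuousAt_log hpos.ne')).mul
        (continuous_negTrace_sub_smul hρ.1 hσ.1).continuousAt).continuousWithinAt
  have h1 : ∫ γ in (0 : ℝ)..b, ((1 + Real.log γ) * distQ ρ σ γ + γ⁻¹ * negTrace (ρ - γ • σ))
      = (1 + Real.log b) * negTrace (ρ - b • σ)
        - (1 + Real.log 0) * negTrace (ρ - (0 : ℝ) • σ) := by
    refine integral_eq_of_hasDerivAt_off_countable_of_le
      (fun γ : ℝ => (1 + Real.log γ) * negTrace (ρ - γ • σ)) _ hb.le
      (countable_not_continuousAt_distQ hρ.1 hσ.1) hcont (fun γ hγ => ?_) (hQ.add hE)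
    have hd := ((Real.hasDerivAt_log hγ.1.1.ne').const_add 1).mul
      (hasDerivAt_negTrace hρ.1 hσ.1 (not_not.mp hγ.2))
    exact hd.congr_deriv (add_comm _ _)
  rw [zero_smul, sub_zero, negTrace_of_posSemidef hρ, mul_zero, sub_zero,
    intervalIntegral.integral_add hQ hE] at h1
  simp only [smul_eq_mul]
  linarith

theorem hasRSIntegral_log_distP (hρ : ρ.PosSemidef) (hσ : σ.PosSemidef) {a b : ℝ} (ha : 0 < a)
    (hab : a < b) :
    HasRSIntegral Real.log (distP ρ σ) a b (Real.log b * distP ρ σ b - Real.log a * distP ρ σ a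
      - ∫ γ in a..b, γ⁻¹ • distP ρ σ γ) := by
  refine hasRSIntegral_of_ae_continuousAt (g' := fun γ => γ⁻¹) (C := ρ.trace.re) hab ?_ ?_ ?_ ?_
  · exact intervalIntegral.intervalIntegrable_inv (fun x hx => by
      rw [Set.uIcc_of_le hab.le] at hx; exact (ha.trans_le hx.1).ne') continuousOn_id
  · intro s hs t ht
    have hs0 := ha.trans_le hs.1
    have ht0 := ha.trans_le ht.1
    rw [integral_inv_of_pos hs0 ht0, Real.log_div ht0.ne' hs0.ne']
  · intro t _
    rw [Real.norm_of_nonneg (distP_nonneg hρ hσ.1 t)]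
    exact distP_le hρ hσ.1 t
  · filter_upwards [(countable_not_continuousAt_distQ hρ.1 hσ.1).ae_notMem volume] with γ hγ _
    exact continuousAt_distP hρ.1 hσ.1 (not_not.mp hγ)

theorem hasRSIntegral_mul_log_distQ (hρ : ρ.PosSemidef) (hσ : σ.PosSemidef) {b : ℝ}
    (hb : 0 < b) :
    HasRSIntegral (fun γ : ℝ => γ * Real.log γ) (distQ ρ σ) 0 b
      (b * Real.log b * distQ ρ σ b - 0 * Real.log 0 * distQ ρ σ 0
      - ∫ γ in (0 : ℝ)..b, (1 + Real.log γ) • distQ ρ σ γ) := by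
  refine hasRSIntegral_of_ae_continuousAt (g := fun γ : ℝ => γ * Real.log γ)
    (g' := fun γ => 1 + Real.log γ) (C := σ.trace.re) hb
    (intervalIntegrable_one_add_log 0 b) ?_ ?_ ?_
  · intro s _ t _
    rw [intervalIntegral.integral_add intervalIntegrable_const
      intervalIntegral.intervalIntegrable_log', integral_log]
    simp
  · intro t _
    rw [Real.norm_of_nonneg (distQ_nonneg hρ.1 hσ t)]
    exact distQ_le hρ.1 hσ t
  · filter_upwards [(countable_not_continuousAt_distQ hρ.1 hσ.1).ae_notMem volume] with γ hγ _
    exact not_not.mp hγ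

theorem projLE_of_posSemidef {γ : ℝ} (h : (γ • σ - ρ).PosSemidef) : projLE ρ (γ • σ) = 1 := by
  rw [projLE_eq]; exact projNonpos_of_neg (by rwa [neg_sub])

theorem integral_negTrace_of_isState (hρ : IsState ρ) (hσ : IsState σ) {b : ℝ} (hb : 1 ≤ b)
    (h : (b • σ - ρ).PosSemidef) :
    ∫ γ in (0 : ℝ)..b, γ⁻¹ * negTrace (ρ - γ • σ)
      = (ρ * (matLog ρ - matLog σ)).trace.re - Real.log b + b - 1 := by
  rw [integral_negTrace_of_posSemidef hρ.1 hσ.1 hb h, hρ.2, hσ.2, mul_sub, Matrix.trace_sub,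
    Complex.sub_re]
  simp

theorem hasRSIntegralIci_mul_log_distQ (hρ : IsState ρ) (hσ : IsState σ) {c : ℝ}
    (hc : (c • σ - ρ).PosSemidef) :
    HasRSIntegralIci (fun γ : ℝ => γ * Real.log γ) (distQ ρ σ)
      (ρ * (matLog ρ - matLog σ)).trace.re := by
  refine ⟨_, fun b hb => hasRSIntegral_mul_log_distQ hρ.1 hσ.1 hb, ?_⟩
  -- Once `b ≥ max c 1`, one has `Q(b) = 1` and `N(b) = b - 1`, and the integral up to `b` is
  -- exactly the relative entropy.
  refine tendsto_const_nhds.congr' ?_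
  filter_upwards [eventually_ge_atTop (max c 1)] with b hb
  have hb1 : 1 ≤ b := (le_max_right _ _).trans hb
  have hbσ := posSemidef_smul_sub_of_le hσ.1 hc ((le_max_left _ _).trans hb)
  rw [integral_one_add_log_mul_distQ hρ.1 hσ.1 (zero_lt_one.trans_le hb1),
    integral_negTrace_of_isState hρ hσ hb1 hbσ, negTrace_sub_smul_of_le hbσ, distQ,
    projLE_of_posSemidef hbσ, mul_one, hρ.2, hσ.2]
  simp
  ring

theorem hasRSIntegralIoi_log_distP (hρ : IsState ρ) (hσ : IsState σ) {c : ℝ}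
    (hc : (c • σ - ρ).PosSemidef) :
    HasRSIntegralIoi Real.log (distP ρ σ) (ρ * (matLog ρ - matLog σ)).trace.re := by
  refine ⟨_, fun a b ha hab => hasRSIntegral_log_distP hρ.1 hσ.1 ha hab, ?_⟩
  set d := (ρ * (matLog ρ - matLog σ)).trace.re
  have hσ1 : σ.trace.re = 1 := by rw [hσ.2]; rfl
  have hρ1 : ρ.trace.re = 1 := by rw [hρ.2]; rfl
  -- For `b ≥ max c 1` the truncated integral no longer depends on `b` and equals this function of
  -- `a`. No bound `a σ ≤ ρ` is available, so a true limit in `a` is needed. It uses `N ≥ 0`, which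
  -- gives `P(a) ≤ a Q(a) ≤ a`, and `N(γ)/γ ≤ Tr σ = 1`.
  have hlim : Tendsto (fun a : ℝ => d - Real.log a * distP ρ σ a + negTrace (ρ - a • σ)
      - ∫ γ in (0 : ℝ)..a, γ⁻¹ * negTrace (ρ - γ • σ)) (𝓝[>] 0) (𝓝 d) := by
    have t1 : Tendsto (fun a : ℝ => Real.log a * distP ρ σ a) (𝓝[>] 0) (𝓝 0) := by
      refine squeeze_zero_norm' (a := fun a => |a * Real.log a|) ?_
        ((Continuous.tendsto' Real.continuous_mul_log.abs 0 0 (by simp)).mono_left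
          nhdsWithin_le_nhds)
      filter_upwards [self_mem_nhdsWithin] with a ha
      have h1 := negTrace_nonneg (isHermitian_sub_smul hρ.1.1 hσ.1.1 a)
      rw [negTrace_eq_distQ_sub_distP] at h1
      have h2 := distQ_le hρ.1.1 hσ.1 a
      have h3 : distP ρ σ a ≤ a := by
        have := mul_le_mul_of_nonneg_left h2 (le_of_lt ha)
        rw [hσ1, mul_one] at this
        linarith
      rw [norm_mul, Real.norm_of_nonneg (distP_nonneg hρ.1 hσ.1.1 a), Real.norm_eq_abs, abs_mul,
        abs_of_pos (Set.mem_Ioi.mp ha : 0 < a), mul_comm]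
      gcongr
    have t2 : Tendsto (fun a : ℝ => negTrace (ρ - a • σ)) (𝓝[>] 0) (𝓝 0) :=
      (Continuous.tendsto' (continuous_negTrace_sub_smul hρ.1.1 hσ.1.1) 0 0
        (by rw [zero_smul, sub_zero]; exact negTrace_of_posSemidef hρ.1)).mono_left
        nhdsWithin_le_nhds
    have t3 : Tendsto (fun a : ℝ => ∫ γ in (0 : ℝ)..a, γ⁻¹ * negTrace (ρ - γ • σ))
        (𝓝[>] 0) (𝓝 0) := by
      refine squeeze_zero_norm' (a := fun a => |a|) ?_
        ((Continuous.tendsto' continuous_abs 0 0 (by simp)).mono_left nhdsWithin_le_nhds)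
      filter_upwards [self_mem_nhdsWithin] with a ha
      have h := intervalIntegral.norm_integral_le_of_norm_le_const (C := 1) (a := 0) (b := a)
        (f := fun γ : ℝ => γ⁻¹ * negTrace (ρ - γ • σ)) fun γ hγ => by
          rw [Set.uIoc_of_le (le_of_lt ha)] at hγ
          exact hσ1 ▸ abs_inv_mul_negTrace_le hρ.1 hσ.1 hγ.1
      simpa using h
    simpa using ((tendsto_const_nhds.sub t1).add t2).sub t3
  refine (hlim.comp (tendsto_fst (g := atTop (α := ℝ)))).congr' ?_
  have hev : ∀ᶠ p : ℝ × ℝ in 𝓝[>] (0 : ℝ) ×ˢ atTop,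
      p.1 ∈ Set.Ioo (0 : ℝ) 1 ∧ p.2 ∈ Set.Ici (max c 1) :=
    prod_mem_prod (Ioo_mem_nhdsGT zero_lt_one) (Ici_mem_atTop _)
  filter_upwards [hev] with ⟨a, b⟩ ⟨ha, hb⟩
  have hb1 : 1 ≤ b := (le_max_right _ _).trans hb
  have hb0 : 0 < b := zero_lt_one.trans_le hb1
  have hab : a ≤ b := ha.2.le.trans hb1
  have hbσ := posSemidef_smul_sub_of_le hσ.1 hc ((le_max_left _ _).trans hb)
  have hI := integral_negTrace_of_isState hρ hσ hb1 hbσ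
  rw [← intervalIntegral.integral_add_adjacent_intervals
    (intervalIntegrable_zero_inv_mul_negTrace hρ.1 hσ.1 ha.1.le)
    (intervalIntegrable_inv_mul_negTrace hρ.1.1 hσ.1.1 ha.1 hb0)] at hI
  have hPb : distP ρ σ b = 1 := by rw [distP, projLE_of_posSemidef hbσ, mul_one, hρ1]
  simp only [Function.comp_apply]
  rw [integral_inv_mul_distP hρ.1.1 hσ.1.1 ha.1 hab, negTrace_sub_smul_of_le hbσ, hPb, hσ1, hρ1]
  linarith

theorem tailP_eq (hρ : IsState ρ) (hσ : IsState σ) :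
    tailP ρ σ = fun γ => 1 - distP ρ σ γ := by
  ext γ
  rw [tailP, projGT_eq (isHermitian_sub_smul hρ.1.1 hσ.1.1 γ), mul_sub, mul_one,
    Matrix.trace_sub, hρ.2, Complex.sub_re, Complex.one_re, distP, projLE_eq]

theorem tailQ_eq (hρ : IsState ρ) (hσ : IsState σ) :
    tailQ ρ σ = fun γ => 1 - distQ ρ σ γ := by
  ext γ
  rw [tailQ, projGT_eq (isHermitian_sub_smul hρ.1.1 hσ.1.1 γ), mul_sub, mul_one,
    Matrix.trace_sub, hσ.2, Complex.sub_re, Complex.one_re, distQ, projLE_eq]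

end States

end QuantumRS

theorem proposition6p2 {n : Type*} [Fintype n] [DecidableEq n] :
    (∀ A B : Matrix n n ℂ, A.PosDef → B.PosDef →
      ∃ I : Matrix n n ℂ,
        QuantumRS.HasRSIntegralIoi Real.log (fun γ : ℝ => QuantumRS.projGT A (γ • B)) I ∧
        QuantumRS.matLog A - QuantumRS.matLog B = -I) ∧
    (∀ ρ σ : Matrix n n ℂ, QuantumRS.IsState ρ → QuantumRS.IsState σ →
      QuantumRS.dMax ρ σ < ⊤ →
      ∃ d : ℝ, QuantumRS.relEntropy ρ σ = (d : EReal) ∧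
        (∃ I : ℝ, QuantumRS.HasRSIntegralIoi Real.log (QuantumRS.tailP ρ σ) I ∧ d = -I) ∧
        QuantumRS.HasRSIntegralIoi Real.log (QuantumRS.distP ρ σ) d ∧
        (∃ I : ℝ, QuantumRS.HasRSIntegralIci (fun γ : ℝ => γ * Real.log γ)
          (QuantumRS.tailQ ρ σ) I ∧ d = -I) ∧
        QuantumRS.HasRSIntegralIci (fun γ : ℝ => γ * Real.log γ) (QuantumRS.distQ ρ σ) d) := by
  refine ⟨fun A B hA hB => ⟨_, QuantumRS.hasRSIntegralIoi_log_projGT hA hB, by rw [neg_sub]⟩,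
    fun ρ σ hρ hσ hd => ?_⟩
  obtain ⟨c, hc⟩ := QuantumRS.exists_posSemidef_of_dMax_lt_top hd
  have hP := QuantumRS.hasRSIntegralIoi_log_distP hρ hσ hc
  have hQ := QuantumRS.hasRSIntegralIci_mul_log_distQ hρ hσ hc
  refine ⟨_, if_pos (QuantumRS.range_mulVecLin_le_of_posSemidef_smul_sub hρ.1 hσ.1 hc),
    ⟨_, ?_, (neg_neg _).symm⟩, hP, ⟨_, ?_, (neg_neg _).symm⟩, hQ⟩
  · rw [QuantumRS.tailP_eq hρ hσ]; exact hP.const_sub 1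
  · rw [QuantumRS.tailQ_eq hρ hσ]; exact hQ.const_sub 1
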